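/- Let $n\ge 1$ and let $\mathcal B_n=\{1\prec\cdots\prec n\prec 0\prec\overline n\prec\cdots\prec\overline 1\}$, with $\overline{\overline k}=k$ and $\overline 0=0$. Crystals below have colours $1,\dots,n$ and operators $\tilde e_i,\tilde f_i$; put $\varepsilon_i(u)=\max\{k:\tilde e_i^k u\ne 0\}$, $\varphi_i(u)=\max\{k:\tilde f_i^k u\neq 0\}$, and use the tensor product rule $\tilde f_i(u\otimes v)=\tilde f_i u\otimes v$ if $\varphi_i(u)>\varepsilon_i(v)$ and $u\otimes\tilde f_i v$ otherwise; $\tilde e_i(u\otimes v)=u\otimes\tilde e_i v$ if $\varphi_i(u)<\varepsilon_i(v)$ and $\tilde e_i u\otimes v$ otherwise. The crystal of the vector representation of $U_q(\mathfrak{so}_{2n+1})$ is $1\xrightarrow{1}2\cdots\xrightarrow{n-1}n\xrightarrow{n}0\xrightarrow{n}\overline n\xrightarrow{n-1}\cdots\xrightarrow{1}\overline1$; its tensor powers make the set of all words on $\mathcal B_n$ a crystal, and $B(w)$ denotes the connected component of the word $w$. Put $v_{\omega_k}=12\cdots k$ for $1\le k\le n$, and let $B(0)$ be the component consisting of the empty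 word. The crystal $B(\Lambda_n^B)$ of the spin representation is the set of spin columns of height $n$, i.e. sets of $n$ letters of $\{1,\dots,n,\overline n,\dots,\overline 1\}$ containing no pair $(z,\overline z)$; $\tilde f_n$ turns $n$ into $\overline n$; for $i<n$, $\tilde f_i$ turns $(i,\overline{i+1})$ into $(i+1,\overline i)$; it is $0$ when the letters to be turned are not all present; $\tilde e_i$ does the converse. A column $C$ is a word $\mathrm w(C)=x_1\cdots x_h$ on $\mathcal B_n$ that increases, where only $0$ may be repeated. It is admissible if $h\le n$ and $|q-p|\ge h-z+1$ whenever $x_p=z$ and $x_q=\overline z$ with $z\in\{1,\dots,n\}$. Let $z_1\succeq\cdots\succeq z_s$ be the letters consisting of all the occurrences of $0$ in $C$ followed by the $z\in\{1,\dots,n\}$ with $z,\overline z\in C$, in decreasing order. Let $t_1$ be the greatest letter with $t_1\prec z_1$, $t_1,\overline{t_1}\notin C$, and for $i\ge2$ let $t_i$ be the greatest letter with $t_i\prec\min(t_{i-1},z_i)$, $t_i,\overline{t_i}\notin C$. Let $lC$ be obtained from $C$ by changing each $z_i$ into $t_i$, and $rC$ by changing each $\overline{z_i}$ into $\overline{t_i}$,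 then reordering. Let $|C|=\{x\in\{1,\dots,n\}: x\in lC\text{ or }\overline x\in lC\}$ (the same set is obtained from $rC$). Lemma. (1) There exists a unique crystal isomorphism (a bijection commuting with all $\tilde e_i,\tilde f_i$) $$S^B:\ B(0)\cup B(v_{\omega_n})\cup\bigcup_{i=1}^{n-1}B(v_{\omega_i})\longrightarrow B(\Lambda_n^B)^{\otimes 2}.$$ (2) For every admissible column $C$, the word $\mathrm w(C)$ lies in the source of $S^B$, the letters $t_1,\dots,t_s$ exist, and $$S^B(\mathrm w(C))=r\mathfrak C\otimes l\mathfrak C,$$ where $l\mathfrak C$ is the spin column of height $n$ obtained by adding to $lC$ the barred letters $\overline x$ with $x\in\{1,\dots,n\}\setminus|C|$, and $r\mathfrak C$ is the spin column of height $n$ obtained by adding to $rC$ the unbarred letters $x\in\{1,\dots,n\}\setminus|C|$. -/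

import Mathlib

/-! Crystal graphs with vertex set `V` and colours `I`, given by Kashiwara's operators;
the value `none` plays the role of `0`. -/

namespace SpinB

structure Crystal (I V : Type) where
  e : I → V → Option V
  f : I → V → Option V

namespace Crystal

variable {I V W : Type}

/-- `ε_i(b) = max {k | e_i^k(b) ≠ 0}` -/
noncomputable def eps (X : Crystal I V) (i : I) (b : V) : ℕ :=
  sSup {k : ℕ | (fun o : Option V => o.bind (X.e i))^[k] (some b) ≠ none}

/-- `φ_i(b) = max {k | f_i^k(b) ≠ 0}` -/
noncomputable def phi (X : Crystal I V) (i : I) (b : V) : ℕ :=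
  sSup {k : ℕ | (fun o : Option V => o.bind (X.f i))^[k] (some b) ≠ none}

/-- The tensor product; the pair `(u, v)` stands for `u ⊗ v`. -/
noncomputable def tensor (X : Crystal I V) (Y : Crystal I W) : Crystal I (V × W) where
  e i p :=
    if X.phi i p.1 < Y.eps i p.2 then (Y.e i p.2).map (fun v => (p.1, v))
    else (X.e i p.1).map (fun u => (u, p.2))
  f i p :=
    if Y.eps i p.2 < X.phi i p.1 then (X.f i p.1).map (fun u => (u, p.2))
    else (Y.f i p.2).map (fun v => (p.1, v))

/-- The crystal `X^{⊗ l}`, its vertices written as words of length `l` on the alphabet `V`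
(only the words of length `l` are meaningful here). -/
noncomputable def tensorPow (X : Crystal I V) : ℕ → Crystal I (List V)
  | 0 =>
    { e := fun _ _ => none
      f := fun _ _ => none }
  | l + 1 =>
    { e := fun i w => match w with
        | [] => none
        | x :: w => ((X.tensor (tensorPow X l)).e i (x, w)).map (fun p => p.1 :: p.2)
      f := fun i w => match w with
        | [] => none
        | x :: w => ((X.tensor (tensorPow X l)).f i (x, w)).map (fun p => p.1 :: p.2) }

/-- The disjoint union over all `l` of the crystals `X^{⊗ l}`; its vertices are the words
of the free monoid on `V`. -/
noncomputable def words (X : Crystal I V) : Crystal I (List V) where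
  e i w := (X.tensorPow w.length).e i w
  f i w := (X.tensorPow w.length).f i w

/-- There is an arrow, of some colour, from `a` to `b`. -/
def Arrow (X : Crystal I V) (a b : V) : Prop :=
  ∃ i, X.f i a = some b ∧ X.e i b = some a

/-- `B(b)`: the vertices of the connected component of `b`. -/
def component (X : Crystal I V) (b : V) : Set V :=
  {c | Relation.EqvGen X.Arrow b c}

open Classical in
/-- The full subgraph with vertex set `s`. -/
noncomputable def restrict (X : Crystal I V) (s : Set V) : Crystal I s where
  e i b := (X.e i b).bind (fun c => if h : c ∈ s then some ⟨c, h⟩ else none)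
  f i b := (X.f i b).bind (fun c => if h : c ∈ s then some ⟨c, h⟩ else none)

/-- Crystal isomorphisms: bijections on vertices that commute with all `e_i` and `f_i`. -/
structure Iso (X : Crystal I V) (Y : Crystal I W) extends V ≃ W where
  map_e : ∀ i b, Y.e i (toEquiv b) = (X.e i b).map toEquiv
  map_f : ∀ i b, Y.f i (toEquiv b) = (X.f i b).map toEquiv

end Crystal

/-- The alphabet `1 ≺ ⋯ ≺ n ≺ 0 ≺ n̄ ≺ ⋯ ≺ 1̄`. The letter `i + 1` is `unbarred i` and its
bar is `barred i`, for `i : Fin n`. Likewise colour `i : Fin n` is the `(i + 1)`-st one. -/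
inductive Letter (n : ℕ) where
  | unbarred (i : Fin n)
  | zero
  | barred (i : Fin n)

namespace Letter

variable {n : ℕ}

/-- The position of a letter in the alphabet. -/
def rank : Letter n → ℕ
  | unbarred i => i
  | zero => n
  | barred i => 2 * n - i

theorem rank_injective : Function.Injective (rank (n := n)) := by
  rintro (i | _ | i) (j | _ | j) h <;> simp only [rank] at h
  · rw [Fin.ext h]
  · omega
  · omega
  · omega
  · rfl
  · omega
  · omega
  · omega
  · rw [Fin.ext (show (i : ℕ) = j by omega)]

instance : LinearOrder (Letter n) := LinearOrder.lift' rank rank_injective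

/-- The bar involution, with `0̄ = 0`. -/
def bar : Letter n → Letter n
  | unbarred i => barred i
  | zero => zero
  | barred i => unbarred i

end Letter

open Letter

/-- The crystal of the vector representation of type `B_n`. -/
def vectorCrystal (n : ℕ) : Crystal (Fin n) (Letter n) where
  e i x := match x with
    | unbarred j => if (j : ℕ) = i + 1 then some (unbarred i) else none
    | zero => if (i : ℕ) + 1 = n then some (unbarred i) else none
    | barred j =>
      if j = i then
        if h : (i : ℕ) + 1 < n then some (barred ⟨i + 1, h⟩) else some zero
      else none
  f i x := match x with
    | unbarred j =>
      if j = i then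
        if h : (i : ℕ) + 1 < n then some (unbarred ⟨i + 1, h⟩) else some zero
      else none
    | zero => if (i : ℕ) + 1 = n then some (barred i) else none
    | barred j => if (j : ℕ) = i + 1 then some (barred i) else none

/-- The crystal on all words in the letters `1, …, n, 0, n̄, …, 1̄`. -/
noncomputable def wordCrystal (n : ℕ) : Crystal (Fin n) (List (Letter n)) :=
  (vectorCrystal n).words

/-- The word `1 2 ⋯ k`, for `k ≤ n`. -/
def fundamentalWord (n k : ℕ) : List (Letter n) :=
  ((List.finRange n).take k).map unbarred

/-- Spin columns of height `n`; an increasing column without pair is given by the set of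
its letters. As `0̄ = 0`, the letter `0` does not occur. -/
@[ext]
structure SpinColumn (n : ℕ) where
  letters : Finset (Letter n)
  card_eq : letters.card = n
  no_pair : ∀ x ∈ letters, bar x ∉ letters

namespace SpinColumn

variable {n : ℕ}

theorem card_turn {c : Finset (Letter n)} {x y : Letter n} (hx : x ∈ c) (hy : y ∉ c) :
    (insert y (c.erase x)).card = c.card := by
  rw [Finset.card_insert_of_notMem (fun h => hy (Finset.mem_of_mem_erase h)),
    Finset.card_erase_add_one hx]

/-- The column obtained by turning the letter `x` into its bar. -/
def turn (c : SpinColumn n) (x : Letter n) (hx : x ∈ c.letters) : SpinColumn n where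
  letters := insert (bar x) (c.letters.erase x)
  card_eq := by rw [card_turn hx (c.no_pair x hx), c.card_eq]
  no_pair := by
    have bb : ∀ y : Letter n, bar (bar y) = y := by rintro (_ | _ | _) <;> rfl
    have h0 := c.no_pair x hx
    intro y hy h
    simp only [Finset.mem_insert, Finset.mem_erase] at hy h
    rcases hy with rfl | ⟨hyx, hy⟩
    · rw [bb] at h
      rcases h with h | h
      · exact h0 (h ▸ hx)
      · exact h.1 rfl
    · rcases h with h | h
      · exact hyx (by rw [← bb y, h, bb])
      · exact c.no_pair y hy h.2

/-- The column obtained by turning the two letters `x, y` into `bar y, bar x`, where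
`x ≠ y`. -/
def turnPair (c : SpinColumn n) (x y : Letter n) (hx : x ∈ c.letters) (hy : y ∈ c.letters)
    (hxy : x ≠ y) : SpinColumn n where
  letters := insert (bar y) (insert (bar x) ((c.letters.erase x).erase y))
  card_eq := by
    have h := ((c.turn x hx).turn y (by
      exact Finset.mem_insert_of_mem (Finset.mem_erase.2 ⟨hxy.symm, hy⟩))).card_eq
    have hne : bar x ≠ y := fun h => c.no_pair x hx (h ▸ hy)
    simpa only [turn, Finset.erase_insert_of_ne hne] using h
  no_pair := by
    have h := ((c.turn x hx).turn y (by
      exact Finset.mem_insert_of_mem (Finset.mem_erase.2 ⟨hxy.symm, hy⟩))).no_pair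
    have hne : bar x ≠ y := fun h => c.no_pair x hx (h ▸ hy)
    simpa only [turn, Finset.erase_insert_of_ne hne] using h

end SpinColumn

/-- The crystal of the spin representation of type `B_n`. The last operator `f_n` turns `n`
into `n̄`; for `i < n`, `f_i` turns the letters `i`, bar of `i + 1` into `i + 1`, bar of `i`;
the `e_i` do the converse. -/
def spinCrystal (n : ℕ) : Crystal (Fin n) (SpinColumn n) where
  e i c :=
    if hi : (i : ℕ) + 1 < n then
      if h : unbarred ⟨i + 1, hi⟩ ∈ c.letters ∧ barred i ∈ c.letters then
        some (c.turnPair (unbarred ⟨i + 1, hi⟩) (barred i) h.1 h.2 (by simp))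
      else none
    else if h : barred i ∈ c.letters then some (c.turn (barred i) h) else none
  f i c :=
    if hi : (i : ℕ) + 1 < n then
      if h : unbarred i ∈ c.letters ∧ barred ⟨i + 1, hi⟩ ∈ c.letters then
        some (c.turnPair (unbarred i) (barred ⟨i + 1, hi⟩) h.1 h.2 (by simp))
      else none
    else if h : unbarred i ∈ c.letters then some (c.turn (unbarred i) h) else none

/-- Columns of type `B`: the letters increase from top to bottom, and only `0` may be
repeated. The list `reading` is the word of the letters from top to bottom. -/
structure Column (n : ℕ) where
  reading : List (Letter n)
  increasing : reading.Pairwise (fun x y => x < y ∨ (x = zero ∧ y = zero))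

namespace Column

variable {n : ℕ}

def height (C : Column n) : ℕ := C.reading.length

/-- Here the unbarred letter `unbarred z` is the number `z + 1`. -/
def Admissible (C : Column n) : Prop :=
  C.height ≤ n ∧
    ∀ (z : Fin n) (p q : Fin C.reading.length),
      C.reading.get p = unbarred z → C.reading.get q = barred z →
        (C.height : ℤ) - ((z : ℤ) + 1) + 1 ≤ |((q : ℕ) : ℤ) - ((p : ℕ) : ℤ)|

/-- The letters `z₁ = 0, …, z_r = 0 ≻ z_{r+1} ≻ ⋯ ≻ z_s` of the pairs `(z, z̄)` in `C`. -/
def pairLetters (C : Column n) : List (Letter n) :=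
  List.replicate (C.reading.count zero) zero ++
    (((List.finRange n).reverse.map unbarred).filter
      (fun z => z ∈ C.reading ∧ bar z ∈ C.reading))

/-- `(t₁, t₂, …)` is the list in which each `t_i` is the greatest letter smaller than `z_i`
and than the previous entry (`b` for the first one) such that neither `t_i` nor its bar
occurs in `C`. -/
def SplitsFrom (C : Column n) : Letter n → List (Letter n) → List (Letter n) → Prop
  | _, [], [] => True
  | b, z :: zs, t :: ts =>
    IsGreatest {s : Letter n | s < min b z ∧ s ∉ C.reading ∧ bar s ∉ C.reading} t ∧
      C.SplitsFrom t zs ts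
  | _, _, _ => False

/-- `J = (t₁ ≻ ⋯ ≻ t_s)` is the list of letters by which `C` is split. There is at most one
such list. The initial bound `0` is no condition on `t₁`, as `t₁ ≺ z₁ ≼ 0`. -/
def IsSplitting (C : Column n) (J : List (Letter n)) : Prop :=
  C.SplitsFrom zero C.pairLetters J

/-- The reading of `lC`: each `z_i` is changed into `t_i`, then one reorders. -/
def left (C : Column n) (J : List (Letter n)) : List (Letter n) :=
  ((C.reading : Multiset (Letter n)) - C.pairLetters + J).sort (· ≤ ·)

/-- The reading of `rC`: the bar of each `z_i` is changed into the bar of `t_i`, then one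
reorders. -/
def right (C : Column n) (J : List (Letter n)) : List (Letter n) :=
  ((C.reading : Multiset (Letter n)) - C.pairLetters.map bar + J.map bar).sort (· ≤ ·)

/-- The unbarred letters `x` such that neither `x` nor its bar occurs in `lC`
(equivalently, in `rC`). -/
def missing (C : Column n) (J : List (Letter n)) : Finset (Fin n) :=
  Finset.univ.filter (fun x => unbarred x ∉ C.left J ∧ barred x ∉ C.left J)

/-- The letters of `lC` together with the missing barred letters. -/
def leftSpinLetters (C : Column n) (J : List (Letter n)) : Finset (Letter n) :=
  (C.left J).toFinset ∪ (C.missing J).image barred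

/-- The letters of `rC` together with the missing unbarred letters. -/
def rightSpinLetters (C : Column n) (J : List (Letter n)) : Finset (Letter n) :=
  (C.right J).toFinset ∪ (C.missing J).image unbarred

end Column

/-- The vertex set `B(0) ∪ B(v_{ω_n}) ∪ ⋃_{1 ≤ i < n} B(v_{ω_i})`, where `B(0)` is the
component of the empty word. -/
def sourceVertices (n : ℕ) : Set (List (Letter n)) :=
  (wordCrystal n).component [] ∪ (wordCrystal n).component (fundamentalWord n n) ∪
    ⋃ i ∈ Set.Ico 1 n, (wordCrystal n).component (fundamentalWord n i)

end SpinB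

/-!
Let `r ⊗ l` be a pair of spin columns. At each letter `z = 1, …, n` it is in one of four states,
according to whether `z` or its bar occurs in `r` and in `l`. If the pair comes from a column
`C`, then `(z, z)` means that `z` is in `C` without its bar, `(z̄, z̄)` that the bar is in `C`
without `z`, `(z̄, z)` that `z` is one of the `t_i`, and `(z, z̄)` that either both letters are
in `C` or neither is. Hence `C` can be read off from the pair, from the smallest letter to the
greatest, by counting the `t_i` whose `z_i` has not been met yet (`Step`, `Splits`): if this
count is positive at a letter in the state `(z, z̄)`, then `z` and `z̄` both belong to `C`,
otherwise neither does; the final count is the number of zeros. This defines `mergeWord` on all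
pairs. Reading from the greatest letter down to the smallest, `C` conversely determines the
pair (`Splits.signs_eq`), so `merge` is injective; and admissibility is the ballot condition
which makes the downward counts end with `0` (`exists_splits`), so that each admissible column
is a value of `merge`.

The operators of colour `i < n` only involve the letters `i`, `i + 1` and their bars, those of
colour `n` only `n`, `0` and the bar of `n`. Going through the few possible states (`Step.swap_f`, `Step.swap_e`) shows that `merge` commutes with them
(`wordCrystal_f_merge`, `wordCrystal_e_merge`).

Finally, every pair is connected to a highest weight vertex, and these are the images of the
words `1 2 ⋯ k` for `0 ≤ k ≤ n`. So the range of `merge` is the source of `S^B`, and `S^B` is the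
inverse of `merge` (`splitIso`). The operators `f_i` tell the highest weight vertices apart,
whence the uniqueness (`eq_self_of_commutes`).
-/

namespace SpinB

/-! ### Words and the tensor product rule -/

namespace Crystal

variable {I V W : Type}

/-- The functions `ε` and `φ` measure the lengths of the `i`-strings of `X`: each of them counts
the steps of its operator down to the end of the string, and the other one backwards. -/
structure StringLengths (X : Crystal I V) (i : I) (ε φ : V → ℕ) : Prop where
  e_none : ∀ b, X.e i b = none → ε b = 0
  e_some : ∀ b c, X.e i b = some c → ε b = ε c + 1 ∧ φ c = φ b + 1
  f_none : ∀ b, X.f i b = none → φ b = 0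
  f_some : ∀ b c, X.f i b = some c → φ b = φ c + 1 ∧ ε c = ε b + 1

theorem sSup_iterate_bind {g : V → Option V} {l : V → ℕ}
    (h0 : ∀ b, g b = none → l b = 0) (h1 : ∀ b c, g b = some c → l b = l c + 1) (b : V) :
    sSup {k : ℕ | (fun o : Option V => o.bind g)^[k] (some b) ≠ none} = l b := by
  have key : ∀ (k : ℕ) (b : V),
      (fun o : Option V => o.bind g)^[k] (some b) ≠ none ↔ k ≤ l b := by
    intro k
    induction k with
    | zero => simp
    | succ k ih =>
      intro b
      rw [Function.iterate_succ_apply]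
      cases hb : g b with
      | none =>
        have hfix : (fun o : Option V => o.bind g)^[k] none = none :=
          Function.iterate_fixed rfl k
        simp [hb, hfix, h0 b hb]
      | some c =>
        have := ih c
        simp only [Option.bind_some, hb, h1 b c hb]
        rw [this]
        omega
  simp only [key]
  exact csSup_Iic

namespace StringLengths

variable {X : Crystal I V} {Y : Crystal I W} {i : I} {ε φ : V → ℕ} {ε' φ' : W → ℕ}

theorem eps_eq (h : X.StringLengths i ε φ) (b : V) : X.eps i b = ε b :=
  sSup_iterate_bind h.e_none (fun b c hc => (h.e_some b c hc).1) b

theorem phi_eq (h : X.StringLengths i ε φ) (b : V) : X.phi i b = φ b :=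
  sSup_iterate_bind h.f_none (fun b c hc => (h.f_some b c hc).1) b

theorem tensor (h : X.StringLengths i ε φ) (h' : Y.StringLengths i ε' φ') :
    (X.tensor Y).StringLengths i (fun p => ε p.1 + (ε' p.2 - φ p.1))
      (fun p => φ' p.2 + (φ p.1 - ε' p.2)) where
  e_none := by
    rintro ⟨u, v⟩ hb
    simp only [Crystal.tensor, h.phi_eq, h'.eps_eq] at hb ⊢
    split_ifs at hb with hlt
    · have := h'.e_none v (by simpa using hb)
      omega
    · have := h.e_none u (by simpa using hb)
      omega
  e_some := by
    rintro ⟨u, v⟩ c hb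
    simp only [Crystal.tensor, h.phi_eq, h'.eps_eq] at hb ⊢
    split_ifs at hb with hlt
    · obtain ⟨w, hw, rfl⟩ := Option.map_eq_some_iff.1 hb
      have := h'.e_some v w hw
      dsimp only
      omega
    · obtain ⟨w, hw, rfl⟩ := Option.map_eq_some_iff.1 hb
      have := h.e_some u w hw
      dsimp only
      omega
  f_none := by
    rintro ⟨u, v⟩ hb
    simp only [Crystal.tensor, h.phi_eq, h'.eps_eq] at hb ⊢
    split_ifs at hb with hlt
    · have := h.f_none u (by simpa using hb)
      omega
    · have := h'.f_none v (by simpa using hb)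
      omega
  f_some := by
    rintro ⟨u, v⟩ c hb
    simp only [Crystal.tensor, h.phi_eq, h'.eps_eq] at hb ⊢
    split_ifs at hb with hlt
    · obtain ⟨w, hw, rfl⟩ := Option.map_eq_some_iff.1 hb
      have := h.f_some u w hw
      dsimp only
      omega
    · obtain ⟨w, hw, rfl⟩ := Option.map_eq_some_iff.1 hb
      have := h'.f_some v w hw
      dsimp only
      omega

end StringLengths

/-- `(ε_i(w), φ_i(w))` for a word `w`, computed letter by letter from the string lengths of
the letters by means of the tensor product rule. -/
def wordLengths (ε φ : V → ℕ) : List V → ℕ × ℕ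
  | [] => (0, 0)
  | x :: w =>
    (ε x + ((wordLengths ε φ w).1 - φ x), (wordLengths ε φ w).2 + (φ x - (wordLengths ε φ w).1))

namespace StringLengths

variable {X : Crystal I V} {i : I} {ε φ : V → ℕ}

/-- In `X^{⊗ l}` only the first `l` letters of a word take part. -/
theorem tensorPow (h : X.StringLengths i ε φ) (l : ℕ) :
    (X.tensorPow l).StringLengths i (fun w => (wordLengths ε φ (w.take l)).1)
      (fun w => (wordLengths ε φ (w.take l)).2) := by
  induction l with
  | zero => constructor <;> simp [Crystal.tensorPow, wordLengths]
  | succ l ih =>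
    have ht := h.tensor ih
    constructor
    · rintro (_ | ⟨x, w⟩) hb
      · simp [wordLengths]
      · exact ht.e_none (x, w) (by simpa [Crystal.tensorPow] using hb)
    · rintro (_ | ⟨x, w⟩) c hb
      · simp [Crystal.tensorPow] at hb
      · obtain ⟨⟨y, v⟩, hp, rfl⟩ := Option.map_eq_some_iff.1 hb
        exact ht.e_some (x, w) (y, v) hp
    · rintro (_ | ⟨x, w⟩) hb
      · simp [wordLengths]
      · exact ht.f_none (x, w) (by simpa [Crystal.tensorPow] using hb)
    · rintro (_ | ⟨x, w⟩) c hb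
      · simp [Crystal.tensorPow] at hb
      · obtain ⟨⟨y, v⟩, hp, rfl⟩ := Option.map_eq_some_iff.1 hb
        exact ht.f_some (x, w) (y, v) hp

theorem words_e_cons (h : X.StringLengths i ε φ) (x : V) (w : List V) :
    X.words.e i (x :: w) =
      if φ x < (wordLengths ε φ w).1 then (X.words.e i w).map (x :: ·)
      else (X.e i x).map (· :: w) := by
  simp only [words, List.length_cons, Crystal.tensorPow, Crystal.tensor, h.phi_eq,
    (h.tensorPow w.length).eps_eq, List.take_length]
  split_ifs <;> simp [Function.comp_def]

theorem words_f_cons (h : X.StringLengths i ε φ) (x : V) (w : List V) :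
    X.words.f i (x :: w) =
      if (wordLengths ε φ w).1 < φ x then (X.f i x).map (· :: w)
      else (X.words.f i w).map (x :: ·) := by
  simp only [words, List.length_cons, Crystal.tensorPow, Crystal.tensor, h.phi_eq,
    (h.tensorPow w.length).eps_eq, List.take_length]
  split_ifs <;> simp [Function.comp_def]

end StringLengths

end Crystal

open Letter Crystal

variable {n : ℕ}

/-- `ε_i` on the letters: `i + 1` and the bar of `i` end an arrow `i`, and for the last colour
`0` ends one and the bar of `n` ends two. -/
def letterEps (i : Fin n) : Letter n → ℕ
  | unbarred j => if (j : ℕ) = i + 1 then 1 else 0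
  | zero => if (i : ℕ) + 1 = n then 1 else 0
  | barred j => if j = i then (if (i : ℕ) + 1 < n then 1 else 2) else 0

/-- `φ_i` on the letters. -/
def letterPhi (i : Fin n) : Letter n → ℕ
  | unbarred j => if j = i then (if (i : ℕ) + 1 < n then 1 else 2) else 0
  | zero => if (i : ℕ) + 1 = n then 1 else 0
  | barred j => if (j : ℕ) = i + 1 then 1 else 0

theorem vectorCrystal_stringLengths (i : Fin n) :
    (vectorCrystal n).StringLengths i (letterEps i) (letterPhi i) := by
  have hi := i.2
  constructor
  · rintro (j | _ | j) h <;> simp only [vectorCrystal, letterEps] at h ⊢ <;>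
      split_ifs at h ⊢ <;> simp_all
  · rintro (j | _ | j) c h <;> simp only [vectorCrystal] at h <;>
      split_ifs at h <;> simp only [Option.some.injEq] at h <;> subst h <;>
      simp only [letterEps, letterPhi, Fin.ext_iff] at * <;> split_ifs <;> omega
  · rintro (j | _ | j) h <;> simp only [vectorCrystal, letterPhi] at h ⊢ <;>
      split_ifs at h ⊢ <;> simp_all
  · rintro (j | _ | j) c h <;> simp only [vectorCrystal] at h <;>
      split_ifs at h <;> simp only [Option.some.injEq] at h <;> subst h <;>
      simp only [letterEps, letterPhi, Fin.ext_iff] at * <;> split_ifs <;> omega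

/-- `ε_i` on words. -/
def wordEps (i : Fin n) (w : List (Letter n)) : ℕ :=
  (wordLengths (letterEps i) (letterPhi i) w).1

@[simp] theorem wordEps_nil (i : Fin n) : wordEps i [] = 0 := rfl

theorem wordEps_cons (i : Fin n) (x : Letter n) (w : List (Letter n)) :
    wordEps i (x :: w) = letterEps i x + (wordEps i w - letterPhi i x) := rfl

theorem wordCrystal_e_cons (i : Fin n) (x : Letter n) (w : List (Letter n)) :
    (wordCrystal n).e i (x :: w) =
      if letterPhi i x < wordEps i w then ((wordCrystal n).e i w).map (x :: ·)
      else ((vectorCrystal n).e i x).map (· :: w) :=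
  (vectorCrystal_stringLengths i).words_e_cons x w

theorem wordCrystal_f_cons (i : Fin n) (x : Letter n) (w : List (Letter n)) :
    (wordCrystal n).f i (x :: w) =
      if wordEps i w < letterPhi i x then ((vectorCrystal n).f i x).map (· :: w)
      else ((wordCrystal n).f i w).map (x :: ·) :=
  (vectorCrystal_stringLengths i).words_f_cons x w

@[simp] theorem wordCrystal_e_nil (i : Fin n) : (wordCrystal n).e i [] = none := rfl

@[simp] theorem wordCrystal_f_nil (i : Fin n) : (wordCrystal n).f i [] = none := rfl

/-- Letters that the colour `i` neither moves nor sees. -/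
def Neutral (i : Fin n) (x : Letter n) : Prop := letterEps i x = 0 ∧ letterPhi i x = 0

theorem Neutral.e_eq_none {i : Fin n} {x : Letter n} (h : Neutral i x) :
    (vectorCrystal n).e i x = none := by
  cases hx : (vectorCrystal n).e i x with
  | none => rfl
  | some c => have := ((vectorCrystal_stringLengths i).e_some x c hx).1; have := h.1; omega

theorem wordEps_neutral_append {i : Fin n} {v : List (Letter n)} (h : ∀ x ∈ v, Neutral i x)
    (w : List (Letter n)) : wordEps i (v ++ w) = wordEps i w := by
  induction v with
  | nil => rfl
  | cons x v ih =>
    have hx := h x (by simp)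
    rw [List.cons_append, wordEps_cons, hx.1, hx.2, ih fun y hy => h y (by simp [hy])]
    simp

theorem wordCrystal_f_neutral_append {i : Fin n} {v : List (Letter n)}
    (h : ∀ x ∈ v, Neutral i x) (w : List (Letter n)) :
    (wordCrystal n).f i (v ++ w) = ((wordCrystal n).f i w).map (v ++ ·) := by
  induction v with
  | nil => simp
  | cons x v ih =>
    have hx := h x (by simp)
    rw [List.cons_append, wordCrystal_f_cons, hx.2, ih fun y hy => h y (by simp [hy])]
    simp [Function.comp_def]

theorem wordCrystal_e_neutral_append {i : Fin n} {v : List (Letter n)}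
    (h : ∀ x ∈ v, Neutral i x) (w : List (Letter n)) :
    (wordCrystal n).e i (v ++ w) = ((wordCrystal n).e i w).map (v ++ ·) := by
  induction v with
  | nil => simp
  | cons x v ih =>
    have hx := h x (by simp)
    rw [List.cons_append, wordCrystal_e_cons, hx.2, ih fun y hy => h y (by simp [hy]),
      hx.e_eq_none]
    split_ifs with hlt
    · simp [Function.comp_def]
    · have : (wordCrystal n).e i w = none := by
        cases w with
        | nil => rfl
        | cons y w =>
          rw [wordEps_neutral_append (fun y hy => h y (by simp [hy])), wordEps_cons] at hlt
          rw [wordCrystal_e_cons, if_neg (by omega)]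
          cases hy : (vectorCrystal n).e i y with
          | none => rfl
          | some c =>
            have := ((vectorCrystal_stringLengths i).e_some y c hy).1
            omega
      simp [this]

theorem wordEps_of_neutral {i : Fin n} {v : List (Letter n)} (h : ∀ x ∈ v, Neutral i x) :
    wordEps i v = 0 := by
  simpa using wordEps_neutral_append h []

theorem wordCrystal_f_of_neutral {i : Fin n} {v : List (Letter n)} (h : ∀ x ∈ v, Neutral i x) :
    (wordCrystal n).f i v = none := by
  simpa using wordCrystal_f_neutral_append h []

theorem wordCrystal_e_of_neutral {i : Fin n} {v : List (Letter n)} (h : ∀ x ∈ v, Neutral i x) :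
    (wordCrystal n).e i v = none := by
  simpa using wordCrystal_e_neutral_append h []

/-! ### The operators on columns -/

/-- The column whose unbarred letters are those marked by `a`, whose barred letters are those
marked by `b`, and in which `0` occurs `k` times, read from top to bottom. -/
def columnWord (a b : Fin n → Bool) (k : ℕ) : List (Letter n) :=
  ((List.finRange n).filter a).map unbarred ++
    (List.replicate k zero ++ ((List.finRange n).reverse.filter b).map barred)

theorem mem_take_finRange {j : ℕ} {x : Fin n} : x ∈ (List.finRange n).take j ↔ (x : ℕ) < j := by
  rw [List.mem_take_iff_getElem]
  constructor
  · rintro ⟨m, hm, rfl⟩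
    simp at hm ⊢
    omega
  · intro h
    exact ⟨x, by simp [h], by simp⟩

theorem mem_drop_finRange {j : ℕ} {x : Fin n} : x ∈ (List.finRange n).drop j ↔ j ≤ (x : ℕ) := by
  rw [List.mem_drop_iff_getElem]
  constructor
  · rintro ⟨m, hm, rfl⟩
    simp
  · intro h
    exact ⟨x - j, by simp; omega, by simp [Fin.ext_iff]; omega⟩

theorem finRange_eq_take_append_drop (i : Fin n) :
    List.finRange n = (List.finRange n).take i ++ i :: (List.finRange n).drop (i + 1) := by
  conv_lhs => rw [← List.take_append_drop i (List.finRange n)]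
  rw [List.drop_eq_getElem_cons (by simp)]
  simp

theorem neutral_unbarred {i j : Fin n} (h : j ≠ i) (h' : (j : ℕ) ≠ i + 1) :
    Neutral i (unbarred j) := by
  simp [Neutral, letterEps, letterPhi, h, h']

theorem neutral_barred {i j : Fin n} (h : j ≠ i) (h' : (j : ℕ) ≠ i + 1) :
    Neutral i (barred j) := by
  simp [Neutral, letterEps, letterPhi, h, h']

theorem neutral_zero {i : Fin n} (h : (i : ℕ) + 1 < n) : Neutral i zero := by
  simp [Neutral, letterEps, letterPhi, h.ne]

/-- For a colour `i` that is not the last one, only the letters `i`, `i + 1` and their bars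
matter in a column; `i'` stands for `i + 1`. -/
theorem columnWord_eq_of_lt {i i' : Fin n} (hi : (i' : ℕ) = i + 1) (a b : Fin n → Bool) (k : ℕ) :
    ∃ v₀ v₁ v₂ : List (Letter n), (∀ x ∈ v₀, Neutral i x) ∧ (∀ x ∈ v₁, Neutral i x) ∧
      (∀ x ∈ v₂, Neutral i x) ∧ ∀ a' b' : Fin n → Bool,
        (∀ j, j ≠ i → j ≠ i' → a' j = a j) → (∀ j, j ≠ i → j ≠ i' → b' j = b j) →
        columnWord a' b' k = v₀ ++ ((if a' i then [unbarred i] else []) ++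
          ((if a' i' then [unbarred i'] else []) ++ (v₁ ++
          ((if b' i' then [barred i'] else []) ++
            ((if b' i then [barred i] else []) ++ v₂))))) := by
  have hsplit : List.finRange n =
      (List.finRange n).take i ++ i :: i' :: (List.finRange n).drop (i' + 1) := by
    conv_lhs => rw [finRange_eq_take_append_drop i, List.drop_eq_getElem_cons (by simp; omega)]
    simp [hi, Fin.ext_iff]
  set L := (List.finRange n).take i with hL
  set R := (List.finRange n).drop (i' + 1) with hR
  have hL' : ∀ x ∈ L, x < i := fun x hx => mem_take_finRange.1 hx
  have hR' : ∀ x ∈ R, i' < x := fun x hx => by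
    have := mem_drop_finRange.1 hx
    exact Fin.lt_def.2 (by omega)
  have hLne : ∀ x ∈ L, x ≠ i ∧ x ≠ i' := fun x hx => by
    have := hL' x hx
    simp only [ne_eq, Fin.ext_iff, Fin.lt_def] at *
    omega
  have hRne : ∀ x ∈ R, x ≠ i ∧ x ≠ i' := fun x hx => by
    have := hR' x hx
    simp only [ne_eq, Fin.ext_iff, Fin.lt_def] at *
    omega
  have hneu : ∀ x : Fin n, x ≠ i ∧ x ≠ i' → Neutral i (unbarred x) ∧ Neutral i (barred x) :=
    fun x hx =>
      have h' : (x : ℕ) ≠ i + 1 := fun h => hx.2 (Fin.ext (by omega))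
      ⟨neutral_unbarred hx.1 h', neutral_barred hx.1 h'⟩
  refine ⟨(L.filter a).map unbarred,
    (R.filter a).map unbarred ++ (List.replicate k zero ++ (R.reverse.filter b).map barred),
    (L.reverse.filter b).map barred, ?_, ?_, ?_, ?_⟩
  · intro x hx
    obtain ⟨y, hy, rfl⟩ := List.mem_map.1 hx
    exact (hneu y (hLne y (List.mem_of_mem_filter hy))).1
  · intro x hx
    rcases List.mem_append.1 hx with hx | hx
    · obtain ⟨y, hy, rfl⟩ := List.mem_map.1 hx
      exact (hneu y (hRne y (List.mem_of_mem_filter hy))).1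
    rcases List.mem_append.1 hx with hx | hx
    · rw [(List.mem_replicate.1 hx).2]
      exact neutral_zero (by omega)
    · obtain ⟨y, hy, rfl⟩ := List.mem_map.1 hx
      exact (hneu y (hRne y (List.mem_reverse.1 (List.mem_of_mem_filter hy)))).2
  · intro x hx
    obtain ⟨y, hy, rfl⟩ := List.mem_map.1 hx
    exact (hneu y (hLne y (List.mem_reverse.1 (List.mem_of_mem_filter hy)))).2
  · intro a' b' ha hb
    have e1 : L.filter a' = L.filter a :=
      List.filter_congr fun x hx => ha x (hLne x hx).1 (hLne x hx).2
    have e2 : R.filter a' = R.filter a :=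
      List.filter_congr fun x hx => ha x (hRne x hx).1 (hRne x hx).2
    have e3 : L.filter b' = L.filter b :=
      List.filter_congr fun x hx => hb x (hLne x hx).1 (hLne x hx).2
    have e4 : R.filter b' = R.filter b :=
      List.filter_congr fun x hx => hb x (hRne x hx).1 (hRne x hx).2
    rw [columnWord, hsplit]
    simp only [List.filter_append, List.filter_cons, List.filter_reverse, List.reverse_append,
      List.reverse_cons, List.map_append, e1, e2, e3, e4, List.append_assoc]
    cases a' i <;> cases a' i' <;> cases b' i <;> cases b' i' <;> simp

/-- For the last colour only the letters `n`, `0` and the bar of `n` matter in a column. -/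
theorem columnWord_eq_of_last {i : Fin n} (hi : (i : ℕ) + 1 = n) (a b : Fin n → Bool) :
    ∃ v₀ v₁ : List (Letter n), (∀ x ∈ v₀, Neutral i x) ∧ (∀ x ∈ v₁, Neutral i x) ∧
      ∀ (a' b' : Fin n → Bool) (k : ℕ),
        (∀ j, j ≠ i → a' j = a j) → (∀ j, j ≠ i → b' j = b j) →
        columnWord a' b' k = v₀ ++ ((if a' i then [unbarred i] else []) ++
          (List.replicate k zero ++ ((if b' i then [barred i] else []) ++ v₁))) := by
  have hsplit : List.finRange n = (List.finRange n).take i ++ [i] := by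
    conv_lhs => rw [finRange_eq_take_append_drop i]
    simp [hi]
  set L := (List.finRange n).take i with hL
  have hL' : ∀ x ∈ L, x < i := fun x hx => mem_take_finRange.1 hx
  have hneu : ∀ x ∈ L, Neutral i (unbarred x) ∧ Neutral i (barred x) := fun x hx =>
    ⟨neutral_unbarred (hL' x hx).ne (by have := x.2; omega),
      neutral_barred (hL' x hx).ne (by have := x.2; omega)⟩
  refine ⟨(L.filter a).map unbarred, (L.reverse.filter b).map barred, ?_, ?_, ?_⟩
  · intro x hx
    obtain ⟨y, hy, rfl⟩ := List.mem_map.1 hx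
    exact (hneu y (List.mem_of_mem_filter hy)).1
  · intro x hx
    obtain ⟨y, hy, rfl⟩ := List.mem_map.1 hx
    exact (hneu y (List.mem_reverse.1 (List.mem_of_mem_filter hy))).2
  · intro a' b' k ha hb
    have e1 : L.filter a' = L.filter a :=
      List.filter_congr fun x hx => ha x (hL' x hx).ne
    have e3 : L.filter b' = L.filter b :=
      List.filter_congr fun x hx => hb x (hL' x hx).ne
    rw [columnWord, hsplit]
    simp only [List.filter_append, List.filter_reverse, List.reverse_append,
      List.map_append, e1, e3, List.append_assoc]
    cases h1 : a' i <;> cases h2 : b' i <;> simp [h1, h2]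

/-- In the colour `i`, the letters `i, i + 1, \bar{i + 1}, \bar i` of a column read `+ - + -`,
and each `+` cancels the next `-`; the leftmost remaining `+` is moved. -/
theorem wordCrystal_f_columnWord_of_lt {i i' : Fin n} (hi : (i' : ℕ) = i + 1)
    (a b : Fin n → Bool) (k : ℕ) :
    (wordCrystal n).f i (columnWord a b k) =
      if a i ∧ !a i' ∧ (b i → b i') then some (columnWord (a ∘ Equiv.swap i i') b k)
      else if b i' ∧ !b i then some (columnWord a (b ∘ Equiv.swap i i') k) else none := by
  obtain ⟨v₀, v₁, v₂, h₀, h₁, h₂, h⟩ := columnWord_eq_of_lt hi a b k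
  have hne : i' ≠ i := by simp [Fin.ext_iff, hi]
  have hlt : (i : ℕ) + 1 < n := by omega
  have hi' : (⟨i + 1, hlt⟩ : Fin n) = i' := Fin.ext hi.symm
  have hsw : ∀ c : Fin n → Bool, ∀ j, j ≠ i → j ≠ i' → (c ∘ Equiv.swap i i') j = c j :=
    fun c j hj hj' => by simp [Equiv.swap_apply_of_ne_of_ne hj hj']
  rw [h a b (fun _ _ _ => rfl) (fun _ _ _ => rfl), h (a ∘ Equiv.swap i i') b (hsw a)
    (fun _ _ _ => rfl), h a (b ∘ Equiv.swap i i') (fun _ _ _ => rfl) (hsw b)]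
  simp only [Function.comp_apply, Equiv.swap_apply_left, Equiv.swap_apply_right]
  rw [wordCrystal_f_neutral_append h₀]
  cases a i <;> cases a i' <;> cases b i <;> cases b i' <;>
    simp [wordCrystal_f_cons, wordEps_cons, wordCrystal_f_neutral_append h₁,
      wordEps_neutral_append h₁, wordCrystal_f_of_neutral h₂, wordEps_of_neutral h₂,
      letterEps, letterPhi, hne, hi, hlt, vectorCrystal, hi']

theorem wordCrystal_e_columnWord_of_lt {i i' : Fin n} (hi : (i' : ℕ) = i + 1)
    (a b : Fin n → Bool) (k : ℕ) :
    (wordCrystal n).e i (columnWord a b k) =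
      if b i ∧ !b i' ∧ (a i → a i') then some (columnWord a (b ∘ Equiv.swap i i') k)
      else if a i' ∧ !a i then some (columnWord (a ∘ Equiv.swap i i') b k) else none := by
  obtain ⟨v₀, v₁, v₂, h₀, h₁, h₂, h⟩ := columnWord_eq_of_lt hi a b k
  have hne : i' ≠ i := by simp [Fin.ext_iff, hi]
  have hlt : (i : ℕ) + 1 < n := by omega
  have hi' : (⟨i + 1, hlt⟩ : Fin n) = i' := Fin.ext hi.symm
  have hsw : ∀ c : Fin n → Bool, ∀ j, j ≠ i → j ≠ i' → (c ∘ Equiv.swap i i') j = c j :=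
    fun c j hj hj' => by simp [Equiv.swap_apply_of_ne_of_ne hj hj']
  rw [h a b (fun _ _ _ => rfl) (fun _ _ _ => rfl), h (a ∘ Equiv.swap i i') b (hsw a)
    (fun _ _ _ => rfl), h a (b ∘ Equiv.swap i i') (fun _ _ _ => rfl) (hsw b)]
  simp only [Function.comp_apply, Equiv.swap_apply_left, Equiv.swap_apply_right]
  rw [wordCrystal_e_neutral_append h₀]
  cases a i <;> cases a i' <;> cases b i <;> cases b i' <;>
    simp [wordCrystal_e_cons, wordEps_cons, wordCrystal_e_neutral_append h₁,
      wordEps_neutral_append h₁, wordCrystal_e_of_neutral h₂, wordEps_of_neutral h₂,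
      letterEps, letterPhi, hne, hi, hlt, vectorCrystal, hi']

theorem wordEps_replicate_zero_append {i : Fin n} (hi : (i : ℕ) + 1 = n) (k : ℕ)
    (w : List (Letter n)) :
    wordEps i (List.replicate (k + 1) zero ++ w) = max 1 (wordEps i w) := by
  induction k with
  | zero =>
    simp only [zero_add, List.replicate_one, List.singleton_append, wordEps_cons, letterEps,
      letterPhi, hi, if_true]
    omega
  | succ k ih =>
    rw [List.replicate_succ, List.cons_append, wordEps_cons, ih]
    simp [letterEps, letterPhi, hi]

theorem wordCrystal_f_replicate_zero {i : Fin n} (hi : (i : ℕ) + 1 = n) (k : ℕ)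
    {w : List (Letter n)} (hw : ∀ x ∈ w, Neutral i x) :
    (wordCrystal n).f i (List.replicate (k + 1) zero ++ w) =
      some (List.replicate k zero ++ barred i :: w) := by
  induction k with
  | zero =>
    simp [wordCrystal_f_cons, wordEps_of_neutral hw, letterPhi, hi, vectorCrystal]
  | succ k ih =>
    rw [List.replicate_succ, List.cons_append, wordCrystal_f_cons, ih,
      wordEps_replicate_zero_append hi, wordEps_of_neutral hw]
    simp [letterPhi, hi, List.replicate_succ]

theorem wordCrystal_f_replicate_zero_barred {i : Fin n} (hi : (i : ℕ) + 1 = n) (k : ℕ)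
    {w : List (Letter n)} (hw : ∀ x ∈ w, Neutral i x) :
    (wordCrystal n).f i (List.replicate k zero ++ barred i :: w) = none ∧
      wordEps i (List.replicate k zero ++ barred i :: w) = 2 := by
  have h1 : wordEps i (barred i :: w) = 2 := by
    simp [wordEps_cons, wordEps_of_neutral hw, letterEps, hi]
  induction k with
  | zero =>
    refine ⟨?_, h1⟩
    simp [wordCrystal_f_cons, wordEps_of_neutral hw, letterPhi, wordCrystal_f_of_neutral hw]
  | succ k ih =>
    refine ⟨?_, by rw [wordEps_replicate_zero_append hi, h1]; rfl⟩
    rw [List.replicate_succ, List.cons_append, wordCrystal_f_cons, ih.1, ih.2]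
    simp [letterPhi, hi]

theorem wordCrystal_e_replicate_zero_barred {i : Fin n} (hi : (i : ℕ) + 1 = n) (k : ℕ)
    {w : List (Letter n)} (hw : ∀ x ∈ w, Neutral i x) :
    (wordCrystal n).e i (List.replicate k zero ++ barred i :: w) =
      some (List.replicate (k + 1) zero ++ w) := by
  induction k with
  | zero =>
    simp [wordCrystal_e_cons, wordEps_of_neutral hw, letterPhi, vectorCrystal, hi]
  | succ k ih =>
    rw [List.replicate_succ, List.cons_append, wordCrystal_e_cons, ih,
      (wordCrystal_f_replicate_zero_barred hi k hw).2]
    simp [letterPhi, hi, List.replicate_succ]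

theorem wordEps_replicate_zero_le {i : Fin n} (hi : (i : ℕ) + 1 = n) (k : ℕ)
    {w : List (Letter n)} (hw : ∀ x ∈ w, Neutral i x) :
    wordEps i (List.replicate k zero ++ w) ≤ 1 := by
  cases k with
  | zero => simp [wordEps_of_neutral hw]
  | succ k => rw [wordEps_replicate_zero_append hi, wordEps_of_neutral hw]; simp

theorem wordCrystal_e_replicate_zero {i : Fin n} (hi : (i : ℕ) + 1 = n) (k : ℕ)
    {w : List (Letter n)} (hw : ∀ x ∈ w, Neutral i x) :
    (wordCrystal n).e i (List.replicate (k + 1) zero ++ w) =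
      some (unbarred i :: (List.replicate k zero ++ w)) := by
  rw [List.replicate_succ, List.cons_append, wordCrystal_e_cons, 
    if_neg (by simpa [letterPhi, hi] using wordEps_replicate_zero_le hi k hw)]
  simp [vectorCrystal, hi]

/-- In the last colour, `n`, `0` and the bar of `n` read `+ +`, `- +` and `- -`. -/
theorem wordCrystal_f_columnWord_of_last {i : Fin n} (hi : (i : ℕ) + 1 = n)
    (a b : Fin n → Bool) (k : ℕ) :
    (wordCrystal n).f i (columnWord a b k) =
      if b i then none
      else if a i then some (columnWord (Function.update a i false) b (k + 1))
      else if 0 < k then some (columnWord a (Function.update b i true) (k - 1)) else none := by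
  obtain ⟨v₀, v₁, h₀, h₁, h⟩ := columnWord_eq_of_last hi a b
  have hup : ∀ (c : Fin n → Bool) (t : Bool), ∀ j, j ≠ i → Function.update c i t j = c j :=
    fun c t j hj => by simp [hj]
  rw [h a b k (fun _ _ => rfl) (fun _ _ => rfl),
    h (Function.update a i false) b (k + 1) (hup a _) (fun _ _ => rfl),
    h a (Function.update b i true) (k - 1) (fun _ _ => rfl) (hup b _)]
  rw [wordCrystal_f_neutral_append h₀]
  obtain ⟨key, key'⟩ := wordCrystal_f_replicate_zero_barred hi k h₁
  have hle : wordEps i (List.replicate k zero ++ v₁) ≤ 1 := wordEps_replicate_zero_le hi k h₁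
  have hf := fun m => wordCrystal_f_replicate_zero hi m h₁
  cases a i <;> cases b i
  · rcases k with _ | k
    · simp [wordCrystal_f_of_neutral h₁]
    · simp [hf]
  · simp [key]
  · simp [wordCrystal_f_cons, letterPhi, hi, vectorCrystal, Nat.lt_succ_of_le hle,
      List.replicate_succ]
  · simp [wordCrystal_f_cons, letterPhi, key, key', hi]

theorem wordCrystal_e_columnWord_of_last {i : Fin n} (hi : (i : ℕ) + 1 = n)
    (a b : Fin n → Bool) (k : ℕ) :
    (wordCrystal n).e i (columnWord a b k) =
      if a i then none
      else if b i then some (columnWord a (Function.update b i false) (k + 1))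
      else if 0 < k then some (columnWord (Function.update a i true) b (k - 1)) else none := by
  obtain ⟨v₀, v₁, h₀, h₁, h⟩ := columnWord_eq_of_last hi a b
  have hup : ∀ (c : Fin n → Bool) (t : Bool), ∀ j, j ≠ i → Function.update c i t j = c j :=
    fun c t j hj => by simp [hj]
  rw [h a b k (fun _ _ => rfl) (fun _ _ => rfl),
    h a (Function.update b i false) (k + 1) (fun _ _ => rfl) (hup b _),
    h (Function.update a i true) b (k - 1) (hup a _) (fun _ _ => rfl)]
  rw [wordCrystal_e_neutral_append h₀]
  obtain ⟨-, key'⟩ := wordCrystal_f_replicate_zero_barred hi k h₁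
  have hle : wordEps i (List.replicate k zero ++ v₁) ≤ 1 := wordEps_replicate_zero_le hi k h₁
  have hv : (vectorCrystal n).e i (unbarred i) = none := by simp [vectorCrystal]
  have hφ : letterPhi i (unbarred i) = 2 := by simp [letterPhi, hi]
  cases a i <;> cases b i
  · rcases k with _ | k
    · simp [wordCrystal_e_of_neutral h₁]
    · simp [wordCrystal_e_replicate_zero hi k h₁]
  · simp [wordCrystal_e_replicate_zero_barred hi k h₁]
  · simp [wordCrystal_e_cons, hφ, hv, hle.trans one_le_two]
  · simp [wordCrystal_e_cons, hφ, hv, key']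

/-! ### Spin columns and their pairs -/

namespace SpinColumn

/-- The sign vector of a spin column: at `j` it is `true` if the column contains the letter
`j + 1`, and `false` if it contains its bar. -/
def signs (c : SpinColumn n) (j : Fin n) : Bool := decide (unbarred j ∈ c.letters)

theorem zero_notMem (c : SpinColumn n) : zero ∉ c.letters := fun h => c.no_pair _ h h

theorem unbarred_mem_iff {c : SpinColumn n} {j : Fin n} :
    unbarred j ∈ c.letters ↔ c.signs j = true := by
  simp [signs]

theorem barred_mem_iff {c : SpinColumn n} {j : Fin n} :
    barred j ∈ c.letters ↔ c.signs j = false := by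
  set U := Finset.univ.filter fun j : Fin n => unbarred j ∈ c.letters with hU
  set B := Finset.univ.filter fun j : Fin n => barred j ∈ c.letters with hB
  have hUB : Disjoint U B := Finset.disjoint_left.2 fun j hj hj' =>
    c.no_pair _ (Finset.mem_filter.1 hj).2 (Finset.mem_filter.1 hj').2
  have hle : c.letters ⊆ U.image unbarred ∪ B.image barred := by
    rintro (k | _ | k) hk
    · simp [hU, hk]
    · exact absurd hk c.zero_notMem
    · simp [hB, hk]
  have hcard : n ≤ (U ∪ B).card := by
    rw [Finset.card_union_of_disjoint hUB]
    calc n = c.letters.card := c.card_eq.symm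
      _ ≤ _ := Finset.card_le_card hle
      _ ≤ _ := Finset.card_union_le _ _
      _ ≤ _ := add_le_add Finset.card_image_le Finset.card_image_le
  have huniv : U ∪ B = Finset.univ :=
    Finset.eq_univ_of_card _ (le_antisymm (Finset.card_le_univ _) (by simpa using hcard))
  have hj : j ∈ U ∪ B := huniv ▸ Finset.mem_univ j
  simp only [hU, hB, Finset.mem_union, Finset.mem_filter, Finset.mem_univ, true_and] at hj
  simp only [signs, decide_eq_false_iff_not]
  exact ⟨fun h h' => c.no_pair _ h' h, fun h => hj.resolve_left h⟩

theorem signs_injective : Function.Injective (signs (n := n)) := by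
  intro c d h
  ext (j | _ | j)
  · rw [unbarred_mem_iff, unbarred_mem_iff, h]
  · simp [zero_notMem]
  · rw [barred_mem_iff, barred_mem_iff, h]

/-- The spin column with a given sign vector. -/
def ofSigns (s : Fin n → Bool) : SpinColumn n where
  letters := Finset.univ.image fun j => if s j then unbarred j else barred j
  card_eq := by
    rw [Finset.card_image_of_injective, Finset.card_univ, Fintype.card_fin]
    intro j k h
    dsimp only at h
    split_ifs at h <;> simp_all
  no_pair := by
    simp only [Finset.mem_image, Finset.mem_univ, true_and, not_exists]
    rintro _ ⟨j, rfl⟩ k h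
    cases hj : s j <;> cases hk : s k <;> simp_all [bar]

@[simp] theorem signs_ofSigns (s : Fin n → Bool) : (ofSigns s).signs = s := by
  ext j
  simp only [signs, ofSigns, Finset.mem_image, Finset.mem_univ, true_and]
  cases hj : s j
  · rw [decide_eq_false]
    rintro ⟨k, hk⟩
    split_ifs at hk
    simp_all
  · rw [decide_eq_true]
    exact ⟨j, by simp [hj]⟩

@[simp] theorem ofSigns_signs (c : SpinColumn n) : ofSigns c.signs = c :=
  signs_injective (signs_ofSigns _)

theorem eq_ofSigns_iff {c : SpinColumn n} {s : Fin n → Bool} : c = ofSigns s ↔ c.signs = s :=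
  ⟨fun h => by rw [h, signs_ofSigns], fun h => by rw [← h, ofSigns_signs]⟩

end SpinColumn

open SpinColumn

theorem spinCrystal_f_of_lt {i i' : Fin n} (hi : (i' : ℕ) = i + 1) (s : Fin n → Bool) :
    (spinCrystal n).f i (ofSigns s) =
      if s i ∧ !s i' then some (ofSigns (s ∘ Equiv.swap i i')) else none := by
  have hlt : (i : ℕ) + 1 < n := by omega
  have hi' : (⟨i + 1, hlt⟩ : Fin n) = i' := Fin.ext hi.symm
  have hne : i ≠ i' := by simp [Fin.ext_iff, hi]
  simp only [spinCrystal, hlt, dif_pos, hi', unbarred_mem_iff, barred_mem_iff, signs_ofSigns]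
  simp only [Bool.not_eq_true', ← dite_eq_ite]
  refine dite_congr rfl (fun h => ?_) fun _ => rfl
  refine congrArg some (eq_ofSigns_iff.2 (funext fun j => Bool.eq_iff_iff.2 ?_))
  rw [← unbarred_mem_iff]
  simp only [turnPair, bar, Finset.mem_insert, Finset.mem_erase, unbarred_mem_iff, signs_ofSigns,
    Function.comp_apply]
  rcases eq_or_ne j i with rfl | hj
  · simp [hne, h]
  rcases eq_or_ne j i' with rfl | hj'
  · simp [h]
  · simp [hj, hj', Equiv.swap_apply_of_ne_of_ne hj hj']

theorem spinCrystal_e_of_lt {i i' : Fin n} (hi : (i' : ℕ) = i + 1) (s : Fin n → Bool) :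
    (spinCrystal n).e i (ofSigns s) =
      if s i' ∧ !s i then some (ofSigns (s ∘ Equiv.swap i i')) else none := by
  have hlt : (i : ℕ) + 1 < n := by omega
  have hi' : (⟨i + 1, hlt⟩ : Fin n) = i' := Fin.ext hi.symm
  have hne : i ≠ i' := by simp [Fin.ext_iff, hi]
  simp only [spinCrystal, hlt, dif_pos, hi', unbarred_mem_iff, barred_mem_iff, signs_ofSigns]
  simp only [Bool.not_eq_true', ← dite_eq_ite]
  refine dite_congr rfl (fun h => ?_) fun _ => rfl
  refine congrArg some (eq_ofSigns_iff.2 (funext fun j => Bool.eq_iff_iff.2 ?_))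
  rw [← unbarred_mem_iff]
  simp only [turnPair, bar, Finset.mem_insert, Finset.mem_erase, unbarred_mem_iff, signs_ofSigns,
    Function.comp_apply]
  rcases eq_or_ne j i with rfl | hj
  · simp [h]
  rcases eq_or_ne j i' with rfl | hj'
  · simp [hj, h]
  · simp [hj, hj', Equiv.swap_apply_of_ne_of_ne hj hj']

theorem spinCrystal_f_of_last {i : Fin n} (hi : (i : ℕ) + 1 = n) (s : Fin n → Bool) :
    (spinCrystal n).f i (ofSigns s) =
      if s i then some (ofSigns (Function.update s i false)) else none := by
  simp only [spinCrystal, hi, lt_irrefl, dif_neg, not_false_iff, unbarred_mem_iff, signs_ofSigns]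
  simp only [← dite_eq_ite]
  refine dite_congr rfl (fun h => ?_) fun _ => rfl
  refine congrArg some (eq_ofSigns_iff.2 (funext fun j => Bool.eq_iff_iff.2 ?_))
  rw [← unbarred_mem_iff]
  simp only [turn, bar, Finset.mem_insert, Finset.mem_erase, unbarred_mem_iff, signs_ofSigns]
  rcases eq_or_ne j i with rfl | hj
  · simp
  · simp [hj]

theorem spinCrystal_e_of_last {i : Fin n} (hi : (i : ℕ) + 1 = n) (s : Fin n → Bool) :
    (spinCrystal n).e i (ofSigns s) =
      if !s i then some (ofSigns (Function.update s i true)) else none := by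
  simp only [spinCrystal, hi, lt_irrefl, dif_neg, not_false_iff, barred_mem_iff, signs_ofSigns]
  simp only [← dite_eq_ite, Bool.not_eq_true']
  refine dite_congr rfl (fun h => ?_) fun _ => rfl
  refine congrArg some (eq_ofSigns_iff.2 (funext fun j => Bool.eq_iff_iff.2 ?_))
  rw [← unbarred_mem_iff]
  simp only [turn, bar, Finset.mem_insert, Finset.mem_erase, unbarred_mem_iff, signs_ofSigns]
  rcases eq_or_ne j i with rfl | hj
  · simp
  · simp [hj]

theorem eq_last_or_exists_succ (i : Fin n) :
    (i : ℕ) + 1 = n ∨ ∃ i' : Fin n, (i' : ℕ) = i + 1 := by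
  rcases (Nat.succ_le_of_lt i.2).eq_or_lt with h | h
  · exact Or.inl h
  · exact Or.inr ⟨⟨i + 1, h⟩, rfl⟩

/-- In the spin crystal every string has length at most one. -/
theorem spinCrystal_stringLengths (i : Fin n) :
    (spinCrystal n).StringLengths i (fun c => if (spinCrystal n).e i c = none then 0 else 1)
      (fun c => if (spinCrystal n).f i c = none then 0 else 1) := by
  have aux : (∀ c d, (spinCrystal n).e i c = some d →
        (spinCrystal n).e i d = none ∧ (spinCrystal n).f i c = none ∧
          (spinCrystal n).f i d ≠ none) ∧
      ∀ c d, (spinCrystal n).f i c = some d →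
        (spinCrystal n).f i d = none ∧ (spinCrystal n).e i c = none ∧
          (spinCrystal n).e i d ≠ none := by
    constructor <;> intro c d h <;>
      obtain ⟨s, rfl⟩ : ∃ s, c = ofSigns s := ⟨_, (ofSigns_signs c).symm⟩ <;>
      rcases eq_last_or_exists_succ i with hi | ⟨i', hi⟩
    · rw [spinCrystal_e_of_last hi] at h
      split_ifs at h with hs
      cases h
      simp_all [spinCrystal_e_of_last hi, spinCrystal_f_of_last hi]
    · rw [spinCrystal_e_of_lt hi] at h
      split_ifs at h with hs
      cases h
      simp_all [spinCrystal_e_of_lt hi, spinCrystal_f_of_lt hi]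
    · rw [spinCrystal_f_of_last hi] at h
      split_ifs at h with hs
      cases h
      simp_all [spinCrystal_e_of_last hi, spinCrystal_f_of_last hi]
    · rw [spinCrystal_f_of_lt hi] at h
      split_ifs at h with hs
      cases h
      simp_all [spinCrystal_e_of_lt hi, spinCrystal_f_of_lt hi]
  constructor
  · intro b h
    simp [h]
  · intro b c h
    have := aux.1 b c h
    simp [h, this]
  · intro b h
    simp [h]
  · intro b c h
    have := aux.2 b c h
    simp [h, this]

/-- The crystal `B(Λ_n)^{⊗ 2}`. -/
noncomputable abbrev pairCrystal (n : ℕ) : Crystal (Fin n) (SpinColumn n × SpinColumn n) :=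
  (spinCrystal n).tensor (spinCrystal n)

theorem pairCrystal_f (i : Fin n) (c d : SpinColumn n) :
    (pairCrystal n).f i (c, d) =
      if (spinCrystal n).f i c ≠ none ∧ (spinCrystal n).e i d = none then
        ((spinCrystal n).f i c).map (·, d)
      else ((spinCrystal n).f i d).map (c, ·) := by
  simp only [tensor, (spinCrystal_stringLengths i).eps_eq, (spinCrystal_stringLengths i).phi_eq]
  by_cases h : (spinCrystal n).f i c = none <;> by_cases h' : (spinCrystal n).e i d = none <;>
    simp [h, h']

theorem pairCrystal_e (i : Fin n) (c d : SpinColumn n) :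
    (pairCrystal n).e i (c, d) =
      if (spinCrystal n).e i d ≠ none ∧ (spinCrystal n).f i c = none then
        ((spinCrystal n).e i d).map (c, ·)
      else ((spinCrystal n).e i c).map (·, d) := by
  simp only [tensor, (spinCrystal_stringLengths i).eps_eq, (spinCrystal_stringLengths i).phi_eq]
  by_cases h : (spinCrystal n).f i c = none <;> by_cases h' : (spinCrystal n).e i d = none <;>
    simp [h, h']

theorem pairCrystal_f_of_lt {i i' : Fin n} (hi : (i' : ℕ) = i + 1) (u v : Fin n → Bool) :
    (pairCrystal n).f i (ofSigns u, ofSigns v) =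
      if u i ∧ !u i' ∧ (v i' → v i) then some (ofSigns (u ∘ Equiv.swap i i'), ofSigns v)
      else if v i ∧ !v i' then some (ofSigns u, ofSigns (v ∘ Equiv.swap i i')) else none := by
  rw [pairCrystal_f, spinCrystal_f_of_lt hi, spinCrystal_f_of_lt hi, spinCrystal_e_of_lt hi]
  cases u i <;> cases u i' <;> cases v i <;> cases v i' <;> simp

theorem pairCrystal_e_of_lt {i i' : Fin n} (hi : (i' : ℕ) = i + 1) (u v : Fin n → Bool) :
    (pairCrystal n).e i (ofSigns u, ofSigns v) =
      if v i' ∧ !v i ∧ (u i → u i') then some (ofSigns u, ofSigns (v ∘ Equiv.swap i i'))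
      else if u i' ∧ !u i then some (ofSigns (u ∘ Equiv.swap i i'), ofSigns v) else none := by
  rw [pairCrystal_e, spinCrystal_e_of_lt hi, spinCrystal_e_of_lt hi, spinCrystal_f_of_lt hi]
  cases u i <;> cases u i' <;> cases v i <;> cases v i' <;> simp

theorem pairCrystal_f_of_last {i : Fin n} (hi : (i : ℕ) + 1 = n) (u v : Fin n → Bool) :
    (pairCrystal n).f i (ofSigns u, ofSigns v) =
      if u i ∧ v i then some (ofSigns (Function.update u i false), ofSigns v)
      else if v i then some (ofSigns u, ofSigns (Function.update v i false)) else none := by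
  rw [pairCrystal_f, spinCrystal_f_of_last hi, spinCrystal_f_of_last hi, spinCrystal_e_of_last hi]
  cases u i <;> cases v i <;> simp

theorem pairCrystal_e_of_last {i : Fin n} (hi : (i : ℕ) + 1 = n) (u v : Fin n → Bool) :
    (pairCrystal n).e i (ofSigns u, ofSigns v) =
      if !u i ∧ !v i then some (ofSigns u, ofSigns (Function.update v i true))
      else if !u i then some (ofSigns (Function.update u i true), ofSigns v) else none := by
  rw [pairCrystal_e, spinCrystal_e_of_last hi, spinCrystal_e_of_last hi, spinCrystal_f_of_last hi]
  cases u i <;> cases v i <;> simp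

/-! ### Columns and pairs of spin columns -/

/-- What a column and a pair `r ⊗ l` of spin columns have in common at one letter `z`. The Booleans
`a`, `b` tell whether `z` and its bar are in the column, `u`, `v` whether `z` is in `r` and
in `l`. The numbers `m`, `m'` count the letters `t_i ≺ z`, respectively `t_i ≼ z`, that belong
to some `z_i ≽ z`, respectively `z_i ≻ z`. -/
inductive Step : ℕ → ℕ → Bool → Bool → Bool → Bool → Prop
  | unbarred (m : ℕ) : Step m m true false true true
  | barred (m : ℕ) : Step m m false true false false
  | pair (m : ℕ) : Step (m + 1) m true true true false
  | partner (m : ℕ) : Step m (m + 1) false false false true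
  | missing : Step 0 0 false false true false

theorem step_iff {m m' : ℕ} {a b u v : Bool} :
    Step m m' a b u v ↔
      (m = m' ∧ a = true ∧ b = false ∧ u = true ∧ v = true) ∨
      (m = m' ∧ a = false ∧ b = true ∧ u = false ∧ v = false) ∨
      (m = m' + 1 ∧ a = true ∧ b = true ∧ u = true ∧ v = false) ∨
      (m' = m + 1 ∧ a = false ∧ b = false ∧ u = false ∧ v = true) ∨
      (m = 0 ∧ m' = 0 ∧ a = false ∧ b = false ∧ u = true ∧ v = false) := by
  constructor
  · rintro (_ | _ | _ | _ | _) <;> simp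
  · rintro (⟨rfl, rfl, rfl, rfl, rfl⟩ | ⟨rfl, rfl, rfl, rfl, rfl⟩ | ⟨rfl, rfl, rfl, rfl, rfl⟩ |
      ⟨rfl, rfl, rfl, rfl, rfl⟩ | ⟨rfl, rfl, rfl, rfl, rfl, rfl⟩)
    exacts [.unbarred _, .barred _, .pair _, .partner _, .missing]

theorem Step.eq_of_column {l m m' : ℕ} {a b u v u' v' : Bool} (h : Step m m' a b u v)
    (h' : Step l m' a b u' v') : m = l ∧ u = u' ∧ v = v' := by
  cases h <;> cases h' <;> simp

/-- The column with unbarred letters `a`, barred letters `b` and `k` letters `0` splits into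
the spin columns with sign vectors `u` (for `r`) and `v` (for `l`). For the letter `z = j + 1`
the number `c j` counts the pairs and zeros `≽ z` whose partners are `≺ z`. -/
structure Splits (c : ℕ → ℕ) (a b : Fin n → Bool) (k : ℕ) (u v : Fin n → Bool) : Prop where
  zero : c 0 = 0
  top : c n = k
  step : ∀ j : Fin n, Step (c j) (c (j + 1)) (a j) (b j) (u j) (v j)

/-- The numbers `c j` of `Splits`, computed from the pair of spin columns. -/
def openCount (u v : Fin n → Bool) : ℕ → ℕ
  | 0 => 0
  | j + 1 =>
    if h : j < n then
      if !u ⟨j, h⟩ && v ⟨j, h⟩ then openCount u v j + 1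
      else if u ⟨j, h⟩ && !v ⟨j, h⟩ then openCount u v j - 1
      else openCount u v j
    else openCount u v j

/-- The column which splits into the spin columns with sign vectors `u` and `v`. -/
def mergeWord (u v : Fin n → Bool) : List (Letter n) :=
  columnWord (fun j => u j && (v j || decide (0 < openCount u v j)))
    (fun j => !v j && (!u j || decide (0 < openCount u v j))) (openCount u v n)

theorem openCount_succ (u v : Fin n → Bool) (j : Fin n) :
    openCount u v (j + 1) = if !u j && v j then openCount u v j + 1
      else if u j && !v j then openCount u v j - 1 else openCount u v j := by
  simp [openCount]

theorem splits_openCount (u v : Fin n → Bool) :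
    Splits (openCount u v) (fun j => u j && (v j || decide (0 < openCount u v j)))
      (fun j => !v j && (!u j || decide (0 < openCount u v j))) (openCount u v n) u v := by
  refine ⟨rfl, rfl, fun j => ?_⟩
  rw [openCount_succ, step_iff]
  cases u j <;> cases v j <;> rcases openCount u v j with _ | m <;> simp

namespace Splits

variable {c c' : ℕ → ℕ} {a b a' b' u v u' v' : Fin n → Bool} {k : ℕ}

theorem openCount_eq (h : Splits c a b k u v) : ∀ j ≤ n, openCount u v j = c j := by
  intro j
  induction j with
  | zero => exact fun _ => h.zero.symm
  | succ j ih =>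
    intro hj
    have hs := h.step ⟨j, hj⟩
    have := openCount_succ u v ⟨j, hj⟩
    dsimp only at hs this
    rw [this, ih (by omega)]
    rcases step_iff.1 hs with h | h | h | h | h <;> simp [h]

theorem mergeWord_eq (h : Splits c a b k u v) : mergeWord u v = columnWord a b k := by
  have hc : ∀ j : Fin n, openCount u v j = c j := fun j => h.openCount_eq j j.2.le
  rw [mergeWord, h.openCount_eq n le_rfl, h.top]
  congr 1 <;> ext j <;> rw [hc] <;> rcases step_iff.1 (h.step j) with h | h | h | h | h <;> simp [h]

/-- A column determines the pair of spin columns into which it splits. -/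
theorem signs_eq (h : Splits c a b k u v) (h' : Splits c' a b k u' v') : u = u' ∧ v = v' := by
  have hc : ∀ d j, j + d = n → c j = c' j := by
    intro d
    induction d with
    | zero =>
      intro j hj
      rw [show j = n from hj, h.top, h'.top]
    | succ d ih =>
      intro j hj
      have e := ih (j + 1) (by omega)
      have hs := h.step ⟨j, by omega⟩
      have hs' := h'.step ⟨j, by omega⟩
      dsimp only at hs hs'
      rw [← e] at hs'
      exact (hs.eq_of_column hs').1
  have hj : ∀ j, u j = u' j ∧ v j = v' j := by
    intro j
    have hs := h.step j
    have hs' := h'.step j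
    rw [← hc (n - (j + 1)) (j + 1) (by omega)] at hs'
    exact (hs.eq_of_column hs').2
  exact ⟨funext fun j => (hj j).1, funext fun j => (hj j).2⟩

/-- Changes at two consecutive letters only affect the count between them. -/
theorem change (h : Splits c a b k u v) {i i' : Fin n} (hi : (i' : ℕ) = i + 1)
    (ha : ∀ j, j ≠ i → j ≠ i' → a' j = a j) (hb : ∀ j, j ≠ i → j ≠ i' → b' j = b j)
    (hu : ∀ j, j ≠ i → j ≠ i' → u' j = u j) (hv : ∀ j, j ≠ i → j ≠ i' → v' j = v j) {m : ℕ}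
    (h₁ : Step (c i) m (a' i) (b' i) (u' i) (v' i))
    (h₂ : Step m (c (i' + 1)) (a' i') (b' i') (u' i') (v' i')) :
    Splits (Function.update c i' m) a' b' k u' v' := by
  refine ⟨?_, ?_, fun j => ?_⟩
  · rw [Function.update_of_ne (by omega), h.zero]
  · rw [Function.update_of_ne (by omega), h.top]
  · rcases eq_or_ne j i with rfl | hj
    · rw [Function.update_of_ne (by omega), ← hi, Function.update_self]
      exact h₁
    rcases eq_or_ne j i' with rfl | hj'
    · rw [Function.update_self, Function.update_of_ne (by omega)]
      exact h₂
    · have hj1 : (j : ℕ) ≠ i' := fun e => hj' (Fin.ext e)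
      have hj2 : (j : ℕ) + 1 ≠ i' := fun e => hj (Fin.ext (by omega))
      rw [Function.update_of_ne hj1, Function.update_of_ne hj2, ha j hj hj', hb j hj hj',
        hu j hj hj', hv j hj hj']
      exact h.step j

theorem change_last (h : Splits c a b k u v) {i : Fin n} (hi : (i : ℕ) + 1 = n)
    (ha : ∀ j, j ≠ i → a' j = a j) (hb : ∀ j, j ≠ i → b' j = b j)
    (hu : ∀ j, j ≠ i → u' j = u j) (hv : ∀ j, j ≠ i → v' j = v j) {m : ℕ}
    (h₁ : Step (c i) m (a' i) (b' i) (u' i) (v' i)) :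
    Splits (Function.update c n m) a' b' m u' v' := by
  refine ⟨?_, by simp, fun j => ?_⟩
  · rw [Function.update_of_ne (by omega), h.zero]
  · rw [Function.update_of_ne (by omega)]
    rcases eq_or_ne j i with rfl | hj
    · rw [hi, Function.update_self]
      exact h₁
    · have hj1 : (j : ℕ) ≠ i := fun e => hj (Fin.ext e)
      rw [Function.update_of_ne (by omega), ha j hj, hb j hj, hu j hj, hv j hj]
      exact h.step j

end Splits

/-- The rules for `f_i` on columns and on pairs of spin columns agree, when read off at the
letters `i` (no prime) and `i + 1` (prime): `f_i` swaps the values of one of `a`, `b` and of one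
of `u`, `v`, or vanishes on both sides. -/
theorem Step.swap_f {m m' m'' : ℕ} {a b u v a' b' u' v' : Bool} (h : Step m m' a b u v)
    (h' : Step m' m'' a' b' u' v') :
    ((a ∧ !a' ∧ (b → b')) ∧ (u ∧ !u' ∧ (v' → v)) ∧
      ∃ l, Step m l a' b u' v ∧ Step l m'' a b' u v') ∨
    ((a ∧ !a' ∧ (b → b')) ∧ ¬(u ∧ !u' ∧ (v' → v)) ∧ (v ∧ !v') ∧
      ∃ l, Step m l a' b u v' ∧ Step l m'' a b' u' v) ∨
    (¬(a ∧ !a' ∧ (b → b')) ∧ (b' ∧ !b) ∧ (u ∧ !u' ∧ (v' → v)) ∧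
      ∃ l, Step m l a b' u' v ∧ Step l m'' a' b u v') ∨
    (¬(a ∧ !a' ∧ (b → b')) ∧ (b' ∧ !b) ∧ ¬(u ∧ !u' ∧ (v' → v)) ∧ (v ∧ !v') ∧
      ∃ l, Step m l a b' u v' ∧ Step l m'' a' b u' v) ∨
    (¬(a ∧ !a' ∧ (b → b')) ∧ ¬(b' ∧ !b) ∧ ¬(u ∧ !u' ∧ (v' → v)) ∧ ¬(v ∧ !v')) := by
  cases h <;> cases h' <;> simp [step_iff]

/-- The analogue of `Step.swap_f` for `e_i`. -/
theorem Step.swap_e {m m' m'' : ℕ} {a b u v a' b' u' v' : Bool} (h : Step m m' a b u v)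
    (h' : Step m' m'' a' b' u' v') :
    ((b ∧ !b' ∧ (a → a')) ∧ (v' ∧ !v ∧ (u → u')) ∧
      ∃ l, Step m l a b' u v' ∧ Step l m'' a' b u' v) ∨
    ((b ∧ !b' ∧ (a → a')) ∧ ¬(v' ∧ !v ∧ (u → u')) ∧ (u' ∧ !u) ∧
      ∃ l, Step m l a b' u' v ∧ Step l m'' a' b u v') ∨
    (¬(b ∧ !b' ∧ (a → a')) ∧ (a' ∧ !a) ∧ (v' ∧ !v ∧ (u → u')) ∧
      ∃ l, Step m l a' b u v' ∧ Step l m'' a b' u' v) ∨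
    (¬(b ∧ !b' ∧ (a → a')) ∧ (a' ∧ !a) ∧ ¬(v' ∧ !v ∧ (u → u')) ∧ (u' ∧ !u) ∧
      ∃ l, Step m l a' b u' v ∧ Step l m'' a b' u v') ∨
    (¬(b ∧ !b' ∧ (a → a')) ∧ ¬(a' ∧ !a) ∧ ¬(v' ∧ !v ∧ (u → u')) ∧ ¬(u' ∧ !u)) := by
  cases h <;> cases h' <;> simp [step_iff]

/-- `mergeWord` on pairs of spin columns; this is the inverse of the isomorphism `S^B`. -/
def merge (p : SpinColumn n × SpinColumn n) : List (Letter n) := mergeWord p.1.signs p.2.signs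

@[simp] theorem merge_ofSigns (u v : Fin n → Bool) :
    merge (ofSigns u, ofSigns v) = mergeWord u v := by
  simp [merge]

theorem comp_swap_of_ne {i i' : Fin n} (s : Fin n → Bool) (j : Fin n) (hj : j ≠ i)
    (hj' : j ≠ i') : (s ∘ Equiv.swap i i') j = s j := by
  simp [Equiv.swap_apply_of_ne_of_ne hj hj']

theorem wordCrystal_f_merge (i : Fin n) (p : SpinColumn n × SpinColumn n) :
    (wordCrystal n).f i (merge p) = ((pairCrystal n).f i p).map merge := by
  obtain ⟨u, v, rfl⟩ : ∃ u v, p = (ofSigns u, ofSigns v) := ⟨p.1.signs, p.2.signs, by simp⟩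
  obtain ⟨c, a, b, k, h⟩ : ∃ c a b k, Splits c a b k u v := ⟨_, _, _, _, splits_openCount u v⟩
  rw [merge_ofSigns, h.mergeWord_eq]
  have hs := h.step i
  rcases eq_last_or_exists_succ i with hi | ⟨i', hi⟩
  · rw [wordCrystal_f_columnWord_of_last hi, pairCrystal_f_of_last hi]
    rw [hi, h.top] at hs
    have hup : ∀ (s : Fin n → Bool) (t : Bool) (j : Fin n), j ≠ i → Function.update s i t j = s j :=
      fun s t j hj => by simp [hj]
    have hrfl : ∀ (s : Fin n → Bool) (j : Fin n), j ≠ i → s j = s j := fun _ _ _ => rfl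
    rcases step_iff.1 hs with ⟨h0, h1, h2, h3, h4⟩ | ⟨h0, h1, h2, h3, h4⟩ | ⟨h0, h1, h2, h3, h4⟩ |
      ⟨h0, h1, h2, h3, h4⟩ | ⟨h0, h0', h1, h2, h3, h4⟩
    · have := h.change_last (m := k + 1) hi (hup a false) (hrfl b) (hup u false) (hrfl v)
        (by simp [step_iff, h0, h2, h4])
      simp [h1, h2, h3, h4, this.mergeWord_eq]
    · simp [h2, h4]
    · simp [h2, h4]
    · have := h.change_last (m := k - 1) hi (hrfl a) (hup b true) (hrfl u) (hup v false)
        (by simp [step_iff, h0, h1, h3])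
      simp [h0, h1, h2, h3, h4] at this ⊢
      simp [this.mergeWord_eq]
    · simp [h0', h1, h2, h4]
  · have hs' := h.step i'
    rw [wordCrystal_f_columnWord_of_lt hi, pairCrystal_f_of_lt hi]
    rw [← hi] at hs
    have hsw := comp_swap_of_ne (i := i) (i' := i')
    have hrfl : ∀ (s : Fin n → Bool) (j : Fin n), j ≠ i → j ≠ i' → s j = s j :=
      fun _ _ _ _ => rfl
    rcases hs.swap_f hs' with ⟨h1, h2, m, h3, h4⟩ | ⟨h1, h2, h2', m, h3, h4⟩ |
      ⟨h1, h1', h2, m, h3, h4⟩ | ⟨h1, h1', h2, h2', m, h3, h4⟩ | ⟨h1, h1', h2, h2'⟩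
    · rw [if_pos h1, if_pos h2, Option.map_some, merge_ofSigns,
        (h.change hi (hsw a) (hrfl b) (hsw u) (hrfl v) (by simpa) (by simpa)).mergeWord_eq]
    · rw [if_pos h1, if_neg h2, if_pos h2', Option.map_some, merge_ofSigns,
        (h.change hi (hsw a) (hrfl b) (hrfl u) (hsw v) (by simpa) (by simpa)).mergeWord_eq]
    · rw [if_neg h1, if_pos h1', if_pos h2, Option.map_some, merge_ofSigns,
        (h.change hi (hrfl a) (hsw b) (hsw u) (hrfl v) (by simpa) (by simpa)).mergeWord_eq]
    · rw [if_neg h1, if_pos h1', if_neg h2, if_pos h2', Option.map_some, merge_ofSigns,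
        (h.change hi (hrfl a) (hsw b) (hrfl u) (hsw v) (by simpa) (by simpa)).mergeWord_eq]
    · rw [if_neg h1, if_neg h1', if_neg h2, if_neg h2', Option.map_none]

theorem wordCrystal_e_merge (i : Fin n) (p : SpinColumn n × SpinColumn n) :
    (wordCrystal n).e i (merge p) = ((pairCrystal n).e i p).map merge := by
  obtain ⟨u, v, rfl⟩ : ∃ u v, p = (ofSigns u, ofSigns v) := ⟨p.1.signs, p.2.signs, by simp⟩
  obtain ⟨c, a, b, k, h⟩ : ∃ c a b k, Splits c a b k u v := ⟨_, _, _, _, splits_openCount u v⟩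
  rw [merge_ofSigns, h.mergeWord_eq]
  have hs := h.step i
  rcases eq_last_or_exists_succ i with hi | ⟨i', hi⟩
  · rw [wordCrystal_e_columnWord_of_last hi, pairCrystal_e_of_last hi]
    rw [hi, h.top] at hs
    have hup : ∀ (s : Fin n → Bool) (t : Bool) (j : Fin n), j ≠ i → Function.update s i t j = s j :=
      fun s t j hj => by simp [hj]
    have hrfl : ∀ (s : Fin n → Bool) (j : Fin n), j ≠ i → s j = s j := fun _ _ _ => rfl
    rcases step_iff.1 hs with ⟨h0, h1, h2, h3, h4⟩ | ⟨h0, h1, h2, h3, h4⟩ | ⟨h0, h1, h2, h3, h4⟩ |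
      ⟨h0, h1, h2, h3, h4⟩ | ⟨h0, h0', h1, h2, h3, h4⟩
    · simp [h1, h3]
    · have := h.change_last (m := k + 1) hi (hrfl a) (hup b false) (hrfl u) (hup v true)
        (by simp [step_iff, h0, h1, h3])
      simp [h1, h2, h3, h4, this.mergeWord_eq]
    · simp [h1, h3]
    · have := h.change_last (m := k - 1) hi (hup a true) (hrfl b) (hup u true) (hrfl v)
        (by simp [step_iff, h0, h2, h4])
      simp [h0, h1, h2, h3, h4] at this ⊢
      simp [this.mergeWord_eq]
    · simp [h0', h1, h2, h3]
  · have hs' := h.step i'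
    rw [wordCrystal_e_columnWord_of_lt hi, pairCrystal_e_of_lt hi]
    rw [← hi] at hs
    have hsw := comp_swap_of_ne (i := i) (i' := i')
    have hrfl : ∀ (s : Fin n → Bool) (j : Fin n), j ≠ i → j ≠ i' → s j = s j :=
      fun _ _ _ _ => rfl
    rcases hs.swap_e hs' with ⟨h1, h2, m, h3, h4⟩ | ⟨h1, h2, h2', m, h3, h4⟩ |
      ⟨h1, h1', h2, m, h3, h4⟩ | ⟨h1, h1', h2, h2', m, h3, h4⟩ | ⟨h1, h1', h2, h2'⟩
    · rw [if_pos h1, if_pos h2, Option.map_some, merge_ofSigns,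
        (h.change hi (hrfl a) (hsw b) (hrfl u) (hsw v) (by simpa) (by simpa)).mergeWord_eq]
    · rw [if_pos h1, if_neg h2, if_pos h2', Option.map_some, merge_ofSigns,
        (h.change hi (hrfl a) (hsw b) (hsw u) (hrfl v) (by simpa) (by simpa)).mergeWord_eq]
    · rw [if_neg h1, if_pos h1', if_pos h2, Option.map_some, merge_ofSigns,
        (h.change hi (hsw a) (hrfl b) (hrfl u) (hsw v) (by simpa) (by simpa)).mergeWord_eq]
    · rw [if_neg h1, if_pos h1', if_neg h2, if_pos h2', Option.map_some, merge_ofSigns,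
        (h.change hi (hsw a) (hrfl b) (hsw u) (hrfl v) (by simpa) (by simpa)).mergeWord_eq]
    · rw [if_neg h1, if_neg h1', if_neg h2, if_neg h2', Option.map_none]

theorem unbarred_mem_columnWord {a b : Fin n → Bool} {k : ℕ} {j : Fin n} :
    unbarred j ∈ columnWord a b k ↔ a j = true := by
  simp [columnWord, List.mem_replicate]

theorem barred_mem_columnWord {a b : Fin n → Bool} {k : ℕ} {j : Fin n} :
    barred j ∈ columnWord a b k ↔ b j = true := by
  simp [columnWord, List.mem_replicate]

theorem count_zero_columnWord (a b : Fin n → Bool) (k : ℕ) :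
    (columnWord a b k).count zero = k := by
  have h1 : ∀ l : List (Fin n), (l.map unbarred).count zero = 0 := fun l =>
    List.count_eq_zero.2 (by simp)
  have h2 : ∀ l : List (Fin n), (l.map barred).count zero = 0 := fun l =>
    List.count_eq_zero.2 (by simp)
  simp [columnWord, List.count_append, h1, h2]

theorem columnWord_injective {a b a' b' : Fin n → Bool} {k k' : ℕ}
    (h : columnWord a b k = columnWord a' b' k') : a = a' ∧ b = b' ∧ k = k' := by
  refine ⟨funext fun j => ?_, funext fun j => ?_, ?_⟩
  · rw [Bool.eq_iff_iff, ← unbarred_mem_columnWord (b := b) (k := k), h, unbarred_mem_columnWord]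
  · rw [Bool.eq_iff_iff, ← barred_mem_columnWord (a := a) (k := k), h, barred_mem_columnWord]
  · rw [← count_zero_columnWord a b k, h, count_zero_columnWord]

theorem merge_injective : Function.Injective (merge (n := n)) := by
  rintro ⟨c, d⟩ ⟨c', d'⟩ h
  obtain ⟨ha, hb, hk⟩ := columnWord_injective h
  have h1 := splits_openCount c.signs d.signs
  have h2 := splits_openCount c'.signs d'.signs
  rw [← ha, ← hb, ← hk] at h2
  obtain ⟨e, e'⟩ := h1.signs_eq h2
  rw [signs_injective e, signs_injective e']

/-! ### Highest weight vertices and the isomorphism -/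

/-- A measure on sign vectors which the operators `e_i` decrease. -/
def depth (s : Fin n → Bool) : ℕ := ∑ j : Fin n, if s j then 0 else n - j

theorem depth_swap_lt {i i' : Fin n} (hi : (i' : ℕ) = i + 1) {s : Fin n → Bool}
    (h : s i' ∧ !s i) : depth (s ∘ Equiv.swap i i') < depth s := by
  have e : depth (s ∘ Equiv.swap i i') =
      ∑ j : Fin n, if s j then 0 else n - (Equiv.swap i i' j : ℕ) := by
    rw [depth, ← Equiv.sum_comp (Equiv.swap i i')]
    simp
  rw [e, depth]
  refine Finset.sum_lt_sum (fun j _ => ?_) ⟨i, Finset.mem_univ i, ?_⟩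
  · rcases eq_or_ne j i with rfl | hj
    · simp_all; omega
    rcases eq_or_ne j i' with rfl | hj'
    · simp [h]
    · simp [Equiv.swap_apply_of_ne_of_ne hj hj']
  · simp_all; omega

theorem depth_update_lt {i : Fin n} {s : Fin n → Bool} (h : !s i) :
    depth (Function.update s i true) < depth s := by
  refine Finset.sum_lt_sum (fun j _ => ?_) ⟨i, Finset.mem_univ i, ?_⟩
  · rcases eq_or_ne j i with rfl | hj
    · simp
    · simp [hj]
  · simp_all

theorem depth_lt_of_e {i : Fin n} {p q : SpinColumn n × SpinColumn n}
    (h : (pairCrystal n).e i p = some q) :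
    depth q.1.signs + depth q.2.signs < depth p.1.signs + depth p.2.signs := by
  obtain ⟨u, v, rfl⟩ : ∃ u v, p = (ofSigns u, ofSigns v) := ⟨p.1.signs, p.2.signs, by simp⟩
  rcases eq_last_or_exists_succ i with hi | ⟨i', hi⟩
  · rw [pairCrystal_e_of_last hi] at h
    split_ifs at h with h1 h2 <;> cases h <;> simp only [signs_ofSigns]
    · have := depth_update_lt h1.2; omega
    · have := depth_update_lt h2; omega
  · rw [pairCrystal_e_of_lt hi] at h
    split_ifs at h with h1 h2 <;> cases h <;> simp only [signs_ofSigns]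
    · have := depth_swap_lt hi ⟨h1.1, h1.2.1⟩; omega
    · have := depth_swap_lt hi h2; omega

theorem pairCrystal_f_of_e {i : Fin n} {p q : SpinColumn n × SpinColumn n}
    (h : (pairCrystal n).e i p = some q) : (pairCrystal n).f i q = some p := by
  obtain ⟨u, v, rfl⟩ : ∃ u v, p = (ofSigns u, ofSigns v) := ⟨p.1.signs, p.2.signs, by simp⟩
  rcases eq_last_or_exists_succ i with hi | ⟨i', hi⟩
  · have hup : ∀ s : Fin n → Bool, s i = false →
        Function.update s i false = s := fun s hs => by rw [← hs, Function.update_eq_self]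
    rw [pairCrystal_e_of_last hi] at h
    split_ifs at h with h1 h2 <;> cases h <;> rw [pairCrystal_f_of_last hi]
    · simp only [Bool.not_eq_true'] at h1
      simp [h1, hup v h1.2]
    · simp only [Bool.not_eq_true'] at h1 h2
      have hv : v i = true := by simpa [h2] using h1
      simp [hv, hup u h2]
  · have hsw : ∀ s : Fin n → Bool, (s ∘ Equiv.swap i i') ∘ Equiv.swap i i' = s := fun s => by
      ext; simp
    rw [pairCrystal_e_of_lt hi] at h
    split_ifs at h with h1 h2 <;> cases h <;> rw [pairCrystal_f_of_lt hi]
    · rw [if_neg, if_pos, hsw] <;> simp_all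
    · rw [if_pos, hsw]
      simp_all

/-- The highest weight vertices of the crystal of pairs; `highest n k` is the image
of `1 2 ⋯ k`. -/
def highest (n k : ℕ) : SpinColumn n × SpinColumn n :=
  (ofSigns fun _ => true, ofSigns fun j => decide ((j : ℕ) < k))

theorem exists_eq_highest {p : SpinColumn n × SpinColumn n}
    (h : ∀ i, (pairCrystal n).e i p = none) : ∃ k ≤ n, p = highest n k := by
  obtain ⟨u, v, rfl⟩ : ∃ u v, p = (ofSigns u, ofSigns v) := ⟨p.1.signs, p.2.signs, by simp⟩
  -- the first factor is of highest weight itself: all its signs are `true`, from the last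
  -- one downwards
  have hu : ∀ d (j : Fin n), (j : ℕ) + d + 1 = n → u j = true := by
    intro d
    induction d with
    | zero =>
      intro j hj
      have := h j
      rw [pairCrystal_e_of_last (by omega)] at this
      split_ifs at this with h1 h2
      simpa using h2
    | succ d ih =>
      intro j hj
      have := h j
      rw [pairCrystal_e_of_lt (i' := ⟨j + 1, by omega⟩) rfl] at this
      split_ifs at this with h1 h2
      have h3 := ih ⟨j + 1, by omega⟩ (by simp only; omega)
      simpa [h3] using h2
  have hu' : ∀ j, u j = true := fun j => hu (n - j - 1) j (by omega)
  -- hence `φ_i` vanishes on it for `i < n`, and in the second factor no sign `true` follows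
  -- a sign `false`
  have hv : ∀ (j : ℕ) (hj : j + 1 < n), v ⟨j, by omega⟩ = false → v ⟨j + 1, hj⟩ = false := by
    intro j hj hvj
    have := h ⟨j, by omega⟩
    rw [pairCrystal_e_of_lt (i' := ⟨j + 1, by omega⟩) rfl] at this
    split_ifs at this with h1 h2
    simpa [hvj, hu'] using h1
  have hex : ∃ m, ∀ hm : m < n, v ⟨m, hm⟩ = false := ⟨n, fun hm => absurd hm (lt_irrefl n)⟩
  classical
  refine ⟨Nat.find hex, Nat.find_min' hex fun hm => absurd hm (lt_irrefl n), ?_⟩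
  have hge : ∀ m, Nat.find hex ≤ m → ∀ hm : m < n, v ⟨m, hm⟩ = false := by
    intro m hm
    induction m, hm using Nat.le_induction with
    | base => exact Nat.find_spec hex
    | succ m _ ih => exact fun hm' => hv m hm' (ih (by omega))
  rw [highest, show u = fun _ => true from funext hu']
  congr 2
  ext j
  by_cases hj : (j : ℕ) < Nat.find hex
  · have := Nat.find_min hex hj
    simp only [not_forall, Bool.not_eq_false] at this
    rw [this.2, decide_eq_true hj]
  · rw [hge j (by omega) j.2, decide_eq_false hj]

theorem pairCrystal_f_highest {k : ℕ} (hk : k ≤ n) (i : Fin n) :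
    (pairCrystal n).f i (highest n k) ≠ none ↔ (i : ℕ) + 1 = k := by
  rw [highest]
  rcases eq_last_or_exists_succ i with hi | ⟨i', hi⟩
  · rw [pairCrystal_f_of_last hi]
    by_cases hik : (i : ℕ) < k
    · simp [hik]
      omega
    · simp [hik]
      omega
  · rw [pairCrystal_f_of_lt hi]
    simp [hi]
    omega

theorem highest_eq_of_f {k k' : ℕ} (hk : k ≤ n) (hk' : k' ≤ n)
    (h : ∀ i, (pairCrystal n).f i (highest n k) = none ↔
      (pairCrystal n).f i (highest n k') = none) : k = k' := by
  have h' : ∀ i : Fin n, (i : ℕ) + 1 = k ↔ (i : ℕ) + 1 = k' := fun i => by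
    rw [← pairCrystal_f_highest hk, ← pairCrystal_f_highest hk', ne_eq, ne_eq, h i]
  rcases k with _ | k
  · rcases k' with _ | k'
    · rfl
    · simpa using (h' ⟨k', hk'⟩).2 rfl
  · exact (h' ⟨k, hk⟩).1 rfl

/-- As the highest weight vertices are told apart by the operators `f_i` that vanish on
them, the crystal of pairs has no endomorphism but the identity. -/
theorem eq_self_of_commutes {τ : SpinColumn n × SpinColumn n → SpinColumn n × SpinColumn n}
    (he : ∀ i p, (pairCrystal n).e i (τ p) = ((pairCrystal n).e i p).map τ)
    (hf : ∀ i p, (pairCrystal n).f i (τ p) = ((pairCrystal n).f i p).map τ)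
    (p : SpinColumn n × SpinColumn n) : τ p = p := by
  by_cases h : ∀ i, (pairCrystal n).e i p = none
  · obtain ⟨k, hk, rfl⟩ := exists_eq_highest h
    obtain ⟨k', hk', h'⟩ := exists_eq_highest (p := τ (highest n k)) fun i => by rw [he, h i]; rfl
    have : k = k' := highest_eq_of_f hk hk' fun i => by rw [← h', hf, Option.map_eq_none_iff]
    rw [h', this]
  · push Not at h
    obtain ⟨i, hi⟩ := h
    obtain ⟨q, hq⟩ := Option.ne_none_iff_exists'.1 hi
    have ih := eq_self_of_commutes he hf q
    have := hf i q
    rw [ih, pairCrystal_f_of_e hq, Option.map_some, Option.some_inj] at this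
    exact this.symm
termination_by depth p.1.signs + depth p.2.signs
decreasing_by exact depth_lt_of_e hq

theorem exists_eqvGen_highest (p : SpinColumn n × SpinColumn n) :
    ∃ k ≤ n, Relation.EqvGen (pairCrystal n).Arrow (highest n k) p := by
  by_cases h : ∀ i, (pairCrystal n).e i p = none
  · obtain ⟨k, hk, rfl⟩ := exists_eq_highest h
    exact ⟨k, hk, .refl _⟩
  · push Not at h
    obtain ⟨i, hi⟩ := h
    obtain ⟨q, hq⟩ := Option.ne_none_iff_exists'.1 hi
    obtain ⟨k, hk, ih⟩ := exists_eqvGen_highest q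
    exact ⟨k, hk, ih.trans _ _ _ (.rel _ _ ⟨i, pairCrystal_f_of_e hq, hq⟩)⟩
termination_by depth p.1.signs + depth p.2.signs
decreasing_by exact depth_lt_of_e hq

theorem merge_highest {k : ℕ} : merge (highest n k) = fundamentalWord n k := by
  have h : Splits (fun _ => 0) (fun j : Fin n => decide ((j : ℕ) < k)) (fun _ => false) 0
      (fun _ => true) (fun j => decide ((j : ℕ) < k)) := by
    refine ⟨rfl, rfl, fun j => ?_⟩
    by_cases hj : (j : ℕ) < k <;> simp [step_iff, hj]
  rw [highest, merge_ofSigns, h.mergeWord_eq, columnWord, fundamentalWord]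
  conv_lhs => rw [← List.take_append_drop k (List.finRange n)]
  rw [List.filter_append, List.filter_eq_self.2 fun x hx => by simpa using mem_take_finRange.1 hx,
    List.filter_eq_nil_iff.2 fun x hx => by simpa using mem_drop_finRange.1 hx]
  simp

theorem mem_sourceVertices_iff {w : List (Letter n)} :
    w ∈ sourceVertices n ↔ ∃ k ≤ n, w ∈ (wordCrystal n).component (fundamentalWord n k) := by
  have h0 : fundamentalWord n 0 = [] := by simp [fundamentalWord]
  simp only [sourceVertices, Set.mem_union, Set.mem_iUnion, Set.mem_Ico, exists_prop]
  constructor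
  · rintro ((h | h) | ⟨k, hk, h⟩)
    · exact ⟨0, n.zero_le, h0 ▸ h⟩
    · exact ⟨n, le_rfl, h⟩
    · exact ⟨k, hk.2.le, h⟩
  · rintro ⟨k, hk, h⟩
    rcases k.eq_zero_or_pos with rfl | hk0
    · exact Or.inl (Or.inl (h0 ▸ h))
    rcases hk.eq_or_lt with rfl | hkn
    · exact Or.inl (Or.inr h)
    · exact Or.inr ⟨k, ⟨hk0, hkn⟩, h⟩

theorem merge_mem_sourceVertices (p : SpinColumn n × SpinColumn n) :
    merge p ∈ sourceVertices n := by
  obtain ⟨k, hk, h⟩ := exists_eqvGen_highest p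
  refine mem_sourceVertices_iff.2 ⟨k, hk, ?_⟩
  rw [← merge_highest]
  change Relation.EqvGen _ _ _
  generalize highest n k = q at h ⊢
  induction h with
  | rel x y h =>
    obtain ⟨i, hf, he⟩ := h
    exact .rel _ _ ⟨i, by rw [wordCrystal_f_merge, hf]; rfl, by rw [wordCrystal_e_merge, he]; rfl⟩
  | refl x => exact .refl _
  | symm x y _ ih => exact ih.symm
  | trans x y z _ _ ih ih' => exact ih.trans _ _ _ ih'

theorem exists_merge_eq {w : List (Letter n)} (hw : w ∈ sourceVertices n) :
    ∃ p, merge p = w := by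
  obtain ⟨k, -, h⟩ := mem_sourceVertices_iff.1 hw
  have key : ∀ x y, Relation.EqvGen (wordCrystal n).Arrow x y →
      ((∃ p, merge p = x) ↔ ∃ p, merge p = y) := by
    intro x y h
    induction h with
    | rel x y h =>
      obtain ⟨i, hf, he⟩ := h
      constructor
      · rintro ⟨p, rfl⟩
        rw [wordCrystal_f_merge] at hf
        obtain ⟨q, -, hq⟩ := Option.map_eq_some_iff.1 hf
        exact ⟨q, hq⟩
      · rintro ⟨p, rfl⟩
        rw [wordCrystal_e_merge] at he
        obtain ⟨q, -, hq⟩ := Option.map_eq_some_iff.1 he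
        exact ⟨q, hq⟩
    | refl x => rfl
    | symm x y _ ih => exact ih.symm
    | trans x y z _ _ ih ih' => exact ih.trans ih'
  exact (key _ _ h).1 ⟨_, merge_highest⟩

/-- The inverse of `S^B`, as a bijection. -/
noncomputable def mergeEquiv (n : ℕ) : SpinColumn n × SpinColumn n ≃ sourceVertices n :=
  Equiv.ofBijective (fun p => ⟨merge p, merge_mem_sourceVertices p⟩)
    ⟨fun _ _ h => merge_injective (congrArg Subtype.val h), fun w =>
      (exists_merge_eq w.2).imp fun _ h => Subtype.ext h⟩

theorem restrict_e_mergeEquiv (i : Fin n) (p : SpinColumn n × SpinColumn n) :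
    ((wordCrystal n).restrict (sourceVertices n)).e i (mergeEquiv n p) =
      ((pairCrystal n).e i p).map (mergeEquiv n) := by
  change ((wordCrystal n).e i (merge p)).bind _ = _
  rw [wordCrystal_e_merge]
  cases (pairCrystal n).e i p with
  | none => rfl
  | some q => exact dif_pos (merge_mem_sourceVertices q)

theorem restrict_f_mergeEquiv (i : Fin n) (p : SpinColumn n × SpinColumn n) :
    ((wordCrystal n).restrict (sourceVertices n)).f i (mergeEquiv n p) =
      ((pairCrystal n).f i p).map (mergeEquiv n) := by
  change ((wordCrystal n).f i (merge p)).bind _ = _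
  rw [wordCrystal_f_merge]
  cases (pairCrystal n).f i p with
  | none => rfl
  | some q => exact dif_pos (merge_mem_sourceVertices q)

/-- The crystal isomorphism `S^B`. -/
noncomputable def splitIso (n : ℕ) :
    Iso ((wordCrystal n).restrict (sourceVertices n)) (pairCrystal n) where
  toEquiv := (mergeEquiv n).symm
  map_e i b := by
    obtain ⟨p, rfl⟩ := (mergeEquiv n).surjective b
    rw [restrict_e_mergeEquiv]
    simp
  map_f i b := by
    obtain ⟨p, rfl⟩ := (mergeEquiv n).surjective b
    rw [restrict_f_mergeEquiv]
    simp

theorem iso_eq_splitIso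
    (T : Iso ((wordCrystal n).restrict (sourceVertices n)) (pairCrystal n)) : T = splitIso n := by
  have h : ∀ p, T.toEquiv (mergeEquiv n p) = p :=
    eq_self_of_commutes (τ := fun p => T.toEquiv (mergeEquiv n p))
      (fun i p => by
        rw [T.map_e, restrict_e_mergeEquiv, Option.map_map]
        rfl)
      fun i p => by
        rw [T.map_f, restrict_f_mergeEquiv, Option.map_map]
        rfl
  have hT : T.toEquiv = (mergeEquiv n).symm := Equiv.ext fun w => by
    obtain ⟨p, rfl⟩ := (mergeEquiv n).surjective w
    rw [h, Equiv.symm_apply_apply]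
  obtain ⟨_, _, _⟩ := T
  subst hT
  rfl

theorem splitIso_apply_of_merge_eq {w : List (Letter n)} (hw : w ∈ sourceVertices n)
    {p : SpinColumn n × SpinColumn n} (h : merge p = w) :
    (splitIso n).toEquiv ⟨w, hw⟩ = p := by
  subst h
  exact (mergeEquiv n).symm_apply_apply p

/-! ### Admissible columns and their splittings -/

/-- The number of the letters `1, …, j` marked by `a`. -/
def prefixCount (a : Fin n → Bool) (j : ℕ) : ℕ := ((List.finRange n).take j).countP a

theorem take_succ_finRange {j : ℕ} (hj : j < n) :
    (List.finRange n).take (j + 1) = (List.finRange n).take j ++ [⟨j, hj⟩] := by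
  rw [List.take_add_one, List.getElem?_eq_getElem (by simpa)]
  simp

theorem prefixCount_succ (a : Fin n → Bool) {j : ℕ} (hj : j < n) :
    prefixCount a (j + 1) = prefixCount a j + if a ⟨j, hj⟩ then 1 else 0 := by
  simp [prefixCount, take_succ_finRange hj, List.countP_append, List.countP_singleton]

/-- The bound holds below every letter once it holds below the letters `z` of the pairs. -/
theorem prefixCount_add_le {a b : Fin n → Bool}
    (h : ∀ z, a z → b z → prefixCount a z + prefixCount b z + 1 ≤ z) :
    ∀ j ≤ n, prefixCount a j + prefixCount b j ≤ j := by
  intro j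
  induction j with
  | zero => simp [prefixCount]
  | succ j ih =>
    intro hj
    have := ih (by omega)
    have hz := h ⟨j, hj⟩
    rw [prefixCount_succ a hj, prefixCount_succ b hj]
    cases ha : a ⟨j, hj⟩ <;> cases hb : b ⟨j, hj⟩ <;> simp_all <;> omega

/-- A column satisfying the admissibility condition splits. The counts are constructed from the
top letter downwards. The count at `j` never exceeds the number of free letters among
`1, …, j` minus the number of pairs there, which is `j - prefixCount a j - prefixCount b j`;
so the counts end with `0`. -/
theorem exists_splits {a b : Fin n → Bool} {k : ℕ}
    (h : ∀ z, a z → b z → prefixCount a z + prefixCount b z + 1 ≤ z)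
    (hk : k + prefixCount a n + prefixCount b n ≤ n) : ∃ c u v, Splits c a b k u v := by
  have key : ∀ j ≤ n, ∀ k, k + prefixCount a j + prefixCount b j ≤ j →
      ∃ (c : ℕ → ℕ) (u v : Fin n → Bool), c 0 = 0 ∧ c j = k ∧
        ∀ z : Fin n, (z : ℕ) < j → Step (c z) (c (z + 1)) (a z) (b z) (u z) (v z) := by
    intro j
    induction j with
    | zero =>
      intro _ k hk
      exact ⟨fun _ => 0, fun _ => true, fun _ => true, rfl, (by omega : 0 = k), by simp⟩
    | succ j ih =>
      intro hj k hk
      have hle := prefixCount_add_le h j (by omega)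
      rw [prefixCount_succ a hj, prefixCount_succ b hj] at hk
      have extend : ∀ k' x y, k' + prefixCount a j + prefixCount b j ≤ j →
          Step k' k (a ⟨j, hj⟩) (b ⟨j, hj⟩) x y →
          ∃ (c : ℕ → ℕ) (u v : Fin n → Bool), c 0 = 0 ∧ c (j + 1) = k ∧
            ∀ z : Fin n, (z : ℕ) < j + 1 → Step (c z) (c (z + 1)) (a z) (b z) (u z) (v z) := by
        intro k' x y hk' hs
        obtain ⟨c, u, v, h0, hc, hstep⟩ := ih (by omega) k' hk'
        refine ⟨Function.update c (j + 1) k, Function.update u ⟨j, hj⟩ x,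
          Function.update v ⟨j, hj⟩ y, by simpa using h0, by simp, fun z hz => ?_⟩
        rw [Function.update_of_ne (by omega)]
        rcases eq_or_ne z ⟨j, hj⟩ with rfl | hne
        · simpa [hc] using hs
        · have hzj : (z : ℕ) ≠ j := fun e => hne (Fin.ext e)
          rw [Function.update_of_ne (by omega), Function.update_of_ne hne,
            Function.update_of_ne hne]
          exact hstep z (by omega)
      cases ha : a ⟨j, hj⟩ <;> cases hb : b ⟨j, hj⟩ <;> simp only [ha, hb] at hk extend <;>
        simp only [if_true, if_false, Bool.false_eq_true] at hk
      · rcases k with _ | k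
        · exact extend 0 _ _ (by omega) .missing
        · exact extend k _ _ (by omega) (.partner k)
      · exact extend k _ _ (by omega) (.barred k)
      · exact extend k _ _ (by omega) (.unbarred k)
      · exact extend (k + 1) _ _ (by omega) (.pair k)
  obtain ⟨c, u, v, h0, hc, hs⟩ := key n le_rfl k hk
  exact ⟨c, u, v, ⟨h0, hc, fun z => hs z z.2⟩⟩

namespace Letter

theorem unbarred_injective : Function.Injective (unbarred (n := n)) := fun _ _ h => by
  cases h; rfl

theorem barred_injective : Function.Injective (barred (n := n)) := fun _ _ h => by
  cases h; rfl

theorem lt_iff_rank {x y : Letter n} : x < y ↔ x.rank < y.rank := Iff.rfl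

theorem le_iff_rank {x y : Letter n} : x ≤ y ↔ x.rank ≤ y.rank := Iff.rfl

theorem unbarred_lt_zero (i : Fin n) : unbarred i < zero := i.2

end Letter

theorem count_map_unbarred (l : List (Fin n)) (x : Letter n) :
    (l.map unbarred).count x = match x with
      | unbarred j => l.count j
      | _ => 0 := by
  cases x with
  | unbarred j => exact List.count_map_of_injective _ _ unbarred_injective _
  | zero => exact List.count_eq_zero.2 (by simp)
  | barred j => exact List.count_eq_zero.2 (by simp)

theorem count_map_barred (l : List (Fin n)) (x : Letter n) :
    (l.map barred).count x = match x with
      | barred j => l.count j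
      | _ => 0 := by
  cases x with
  | barred j => exact List.count_map_of_injective _ _ barred_injective _
  | zero => exact List.count_eq_zero.2 (by simp)
  | unbarred j => exact List.count_eq_zero.2 (by simp)

theorem count_filter_finRange (a : Fin n → Bool) (j : Fin n) :
    ((List.finRange n).filter a).count j = if a j then 1 else 0 := by
  rw [((List.nodup_finRange n).filter a).count]
  simp

theorem count_columnWord (a b : Fin n → Bool) (k : ℕ) (x : Letter n) :
    (columnWord a b k).count x = match x with
      | unbarred j => if a j then 1 else 0
      | zero => k
      | barred j => if b j then 1 else 0 := by
  cases x <;> simp [columnWord, List.count_append, count_map_unbarred, count_map_barred,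
    count_filter_finRange, List.count_replicate]

theorem pairwise_columnWord (a b : Fin n → Bool) (k : ℕ) :
    (columnWord a b k).Pairwise (· ≤ ·) := by
  have hfin := List.pairwise_lt_finRange n
  simp only [columnWord, List.pairwise_append, List.pairwise_map, List.filter_reverse,
    List.pairwise_reverse, List.mem_append, List.mem_map, List.mem_replicate]
  refine ⟨(hfin.filter a).imp fun h => ?_, ⟨List.pairwise_replicate.2 (Or.inr le_rfl),
    (hfin.filter b).imp fun {i j} h => ?_, ?_⟩, ?_⟩
  · exact le_iff_rank.2 (Fin.lt_def.1 h).le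
  · rw [le_iff_rank]
    simp only [rank]
    omega
  · rintro _ ⟨-, rfl⟩ _ ⟨i, -, rfl⟩
    rw [le_iff_rank]
    simp only [rank]
    omega
  · rintro _ ⟨i, -, rfl⟩ _ (⟨-, rfl⟩ | ⟨j, -, rfl⟩)
    · exact (unbarred_lt_zero i).le
    · rw [le_iff_rank]
      simp only [rank]
      omega

theorem length_columnWord (a b : Fin n → Bool) (k : ℕ) :
    (columnWord a b k).length = k + prefixCount a n + prefixCount b n := by
  have h : (List.finRange n).take n = List.finRange n := List.take_of_length_le (by simp)
  simp [columnWord, prefixCount, h, List.countP_eq_length_filter, List.filter_reverse]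
  omega

theorem columnWord_eq_of_pair {a b : Fin n → Bool} (k : ℕ) {z : Fin n} (ha : a z) (hb : b z) :
    ∃ v₀ v₁ v₂ : List (Letter n),
      columnWord a b k = v₀ ++ unbarred z :: (v₁ ++ barred z :: v₂) ∧
      v₀.length = prefixCount a z ∧ v₂.length = prefixCount b z := by
  set L := (List.finRange n).take z with hL
  set R := (List.finRange n).drop (z + 1) with hR
  refine ⟨(L.filter a).map unbarred, (R.filter a).map unbarred ++
    (List.replicate k zero ++ (R.reverse.filter b).map barred), (L.reverse.filter b).map barred,
    ?_, ?_, ?_⟩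
  · rw [columnWord, finRange_eq_take_append_drop z, ← hL, ← hR]
    simp [List.filter_append, List.filter_reverse, ha, hb]
  · simp [prefixCount, ← hL, List.countP_eq_length_filter]
  · simp [prefixCount, ← hL, List.countP_eq_length_filter, List.filter_reverse]

namespace Column

/-- Which unbarred letters occur in the column. -/
def hasUnbarred (C : Column n) (j : Fin n) : Bool := decide (unbarred j ∈ C.reading)

/-- Which barred letters occur in the column. -/
def hasBarred (C : Column n) (j : Fin n) : Bool := decide (barred j ∈ C.reading)

theorem count_le_one (C : Column n) {x : Letter n} (hx : x ≠ zero) : C.reading.count x ≤ 1 := by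
  by_contra h
  have h2 : (List.replicate 2 x).Sublist C.reading := List.replicate_sublist_iff.2 (by omega)
  have := C.increasing.sublist h2
  simp [hx] at this

theorem reading_eq (C : Column n) :
    C.reading = columnWord C.hasUnbarred C.hasBarred (C.reading.count zero) := by
  have h1 : C.reading.Pairwise (· ≤ ·) := C.increasing.imp fun h => by
    rcases h with h | ⟨rfl, rfl⟩
    · exact h.le
    · exact le_rfl
  refine List.Perm.eq_of_pairwise' h1 (pairwise_columnWord _ _ _) (List.perm_iff_count.2 ?_)
  have key : ∀ x : Letter n, x ≠ zero →
      C.reading.count x = if decide (x ∈ C.reading) then 1 else 0 := by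
    intro x hx
    by_cases hm : x ∈ C.reading
    · have := C.count_le_one hx
      have := List.count_pos_iff.2 hm
      simp only [hm, decide_true, if_true]
      omega
    · simp [hm, List.count_eq_zero.2 hm]
  rintro (j | _ | j) <;> rw [count_columnWord]
  · exact key _ (by simp)
  · exact key _ (by simp)

theorem Admissible.exists_splits {C : Column n} (hC : C.Admissible) :
    ∃ c u v, Splits c C.hasUnbarred C.hasBarred (C.reading.count zero) u v := by
  have hlen := congrArg List.length C.reading_eq
  rw [length_columnWord] at hlen
  refine SpinB.exists_splits (fun z ha hb => ?_) (hlen ▸ hC.1)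
  obtain ⟨v₀, v₁, v₂, h, h₀, h₂⟩ := columnWord_eq_of_pair (C.reading.count zero) ha hb
  rw [← C.reading_eq] at h
  have hl : C.reading.length = v₀.length + v₁.length + v₂.length + 2 := by
    rw [h]
    simp
    omega
  have := hC.2 z ⟨v₀.length, by omega⟩ ⟨v₀.length + 1 + v₁.length, by omega⟩
    (by simp [h]) (by
      rw [List.get_eq_getElem, List.getElem_of_eq h, List.getElem_append_right (by simp; omega)]
      simp only [show v₀.length + 1 + v₁.length - v₀.length = v₁.length + 1 by omega]
      simp)
  dsimp only [height] at this
  rw [hl] at this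
  push_cast at this
  rw [abs_of_nonneg (by omega)] at this
  omega

theorem filter_reverse_take_succ (p : Fin n → Bool) {j : ℕ} (hj : j < n) :
    ((List.finRange n).take (j + 1)).reverse.filter p =
      (if p ⟨j, hj⟩ then [⟨j, hj⟩] else []) ++ ((List.finRange n).take j).reverse.filter p := by
  rw [take_succ_finRange hj, List.reverse_append, List.filter_append]
  cases h : p ⟨j, hj⟩ <;> simp [h]

/-- The list of the letters `t_i`: those in `l` but not in `r`, from the greatest to the
smallest. -/
def partners (u v : Fin n → Bool) : List (Letter n) :=
  ((List.finRange n).reverse.filter fun j => !u j && v j).map unbarred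

variable {C : Column n} {c : ℕ → ℕ} {u v : Fin n → Bool}

/-- The search for the `t_i`, when the letters greater than `j` have been dealt with: `b` is the
last `t_i` found, and the queue `Q` lists the `z_i` greater than `j` that still lack a partner.
No letter greater than `j` is a candidate for any of them. -/
theorem splitsFrom_of_splits
    (h : Splits c C.hasUnbarred C.hasBarred (C.reading.count zero) u v) :
    ∀ j ≤ n, ∀ (Q : List (Letter n)) (b : Letter n), Q.length = c j →
      (∀ x : Fin n, j ≤ (x : ℕ) → unbarred x ∉ C.reading → barred x ∉ C.reading →
        unbarred x < b → ∀ q ∈ Q, q < unbarred x) →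
      (∀ x : Fin n, (x : ℕ) < j → unbarred x < b ∧ ∀ q ∈ Q, unbarred x < q) → b ≤ zero →
      C.SplitsFrom b
        (Q ++ (((List.finRange n).take j).reverse.filter
          fun z => C.hasUnbarred z && C.hasBarred z).map unbarred)
        ((((List.finRange n).take j).reverse.filter fun z => !u z && v z).map unbarred) := by
  intro j
  induction j with
  | zero =>
    intro _ Q b hQ _ _ _
    rw [h.zero, List.length_eq_zero_iff] at hQ
    subst hQ
    trivial
  | succ j ih =>
    intro hj Q b hQ hfree hlt hb
    have hs := h.step ⟨j, hj⟩
    simp only [filter_reverse_take_succ _ hj]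
    have hlt' : ∀ x : Fin n, (x : ℕ) < j → unbarred x < b ∧ ∀ q ∈ Q, unbarred x < q :=
      fun x hx => hlt x (by omega)
    have hfree' : (unbarred ⟨j, hj⟩ ∈ C.reading ∨ barred ⟨j, hj⟩ ∈ C.reading) →
        ∀ x : Fin n, j ≤ (x : ℕ) → unbarred x ∉ C.reading → barred x ∉ C.reading →
        unbarred x < b → ∀ q ∈ Q, q < unbarred x := by
      intro hm x hx h1 h2
      refine hfree x (Nat.lt_of_le_of_ne hx ?_) h1 h2
      rintro rfl
      exact hm.elim h1 h2
    rcases step_iff.1 hs with ⟨h0, h1, h2, h3, h4⟩ | ⟨h0, h1, h2, h3, h4⟩ |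
      ⟨h0, h1, h2, h3, h4⟩ | ⟨h0, h1, h2, h3, h4⟩ | ⟨h0, h0', h1, h2, h3, h4⟩ <;>
      simp only [h1, h2, h3, h4] <;> dsimp only at h0 <;> (try dsimp only at h0') <;>
      simp only [hasUnbarred, hasBarred, decide_eq_true_eq, decide_eq_false_iff_not] at h1 h2
    · exact ih (by omega) Q b (by omega) (hfree' (Or.inl h1)) hlt' hb
    · exact ih (by omega) Q b (by omega) (hfree' (Or.inr h2)) hlt' hb
    -- a pair: its letter joins the end of the queue
    · have := ih (by omega) (Q ++ [unbarred ⟨j, hj⟩]) b (by simp; omega)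
        (fun x hx h1' h2' hxb => ?_) (fun x hx => ⟨(hlt' x hx).1, fun q hq => ?_⟩) hb
      · simpa using this
      · have hxj : j < (x : ℕ) := by
          refine Nat.lt_of_le_of_ne hx ?_
          rintro rfl
          exact h1' h1
        intro q hq
        rcases List.mem_append.1 hq with hq | hq
        · exact hfree' (Or.inl h1) x hx h1' h2' hxb q hq
        · rw [List.mem_singleton.1 hq]
          exact hxj
      · rcases List.mem_append.1 hq with hq | hq
        · exact (hlt' x hx).2 q hq
        · rw [List.mem_singleton.1 hq]
          exact hx
    -- a partner: it is the greatest candidate for the first letter of the queue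
    · obtain ⟨z, Q, rfl⟩ : ∃ z Q', Q = z :: Q' := List.exists_cons_of_length_pos (by omega)
      have hjlt := hlt ⟨j, hj⟩ (Nat.lt_succ_self j)
      refine ⟨⟨⟨lt_min hjlt.1 (hjlt.2 z (by simp)), h1, h2⟩, ?_⟩, ?_⟩
      · rintro s ⟨hs, hs1, hs2⟩
        obtain ⟨hsb, hsz⟩ := lt_min_iff.1 hs
        rcases s with x | _ | x
        · by_contra hx
          have hx' : j < (x : ℕ) := not_le.1 hx
          exact (hfree x hx' hs1 hs2 hsb z (by simp)).asymm hsz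
        · exact absurd (hsb.trans_le hb) (lt_irrefl _)
        · have := lt_iff_rank.1 (hsb.trans_le hb)
          simp only [rank] at this
          omega
      · refine ih (by omega) Q (unbarred ⟨j, hj⟩) (by simp at hQ; omega) ?_ ?_
          (unbarred_lt_zero _).le
        · intro x hx _ _ hxj
          exact absurd hx (not_le.2 hxj)
        · exact fun x hx => ⟨hx, fun q hq => (hlt' x hx).2 q (by simp [hq])⟩
    -- a missing letter: the queue is empty, so no letter is looking for a partner
    · obtain rfl : Q = [] := List.length_eq_zero_iff.1 (by omega)
      exact ih (by omega) [] b (by simp [h0]) (by simp) (fun x hx => ⟨(hlt' x hx).1, by simp⟩) hb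

theorem pairLetters_eq (C : Column n) :
    C.pairLetters = List.replicate (C.reading.count zero) zero ++
      ((List.finRange n).reverse.filter
        fun z => C.hasUnbarred z && C.hasBarred z).map unbarred := by
  rw [pairLetters, List.filter_map]
  congr 3
  ext z
  rw [Bool.eq_iff_iff]
  simp only [hasUnbarred, hasBarred, bar, Function.comp_apply, Bool.and_eq_true,
    decide_eq_true_eq]
  exact decide_eq_true_iff

theorem isSplitting_of_splits
    (h : Splits c C.hasUnbarred C.hasBarred (C.reading.count zero) u v) :
    C.IsSplitting (partners u v) := by
  have := splitsFrom_of_splits h n le_rfl (List.replicate (C.reading.count zero) zero) zero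
    (by rw [h.top, List.length_replicate]) (fun x hx => absurd x.2 (not_lt.2 hx))
    (fun x _ => ⟨unbarred_lt_zero x, fun q hq => by
      rw [(List.mem_replicate.1 hq).2]; exact unbarred_lt_zero x⟩) le_rfl
  rw [List.take_of_length_le (by simp), ← pairLetters_eq] at this
  exact this

theorem mem_left_iff (C : Column n) {J : List (Letter n)} {x : Letter n} :
    x ∈ C.left J ↔ 0 < C.reading.count x - C.pairLetters.count x + J.count x := by
  rw [left, Multiset.mem_sort, ← Multiset.count_pos, Multiset.count_add, Multiset.count_sub]
  simp only [Multiset.coe_count]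

theorem mem_right_iff (C : Column n) {J : List (Letter n)} {x : Letter n} :
    x ∈ C.right J ↔ 0 < C.reading.count x - (C.pairLetters.map bar).count x +
      (J.map bar).count x := by
  rw [right, Multiset.mem_sort, ← Multiset.count_pos, Multiset.count_add, Multiset.count_sub]
  simp only [Multiset.coe_count]

theorem count_reading (C : Column n) (x : Letter n) :
    C.reading.count x = match x with
      | unbarred j => if C.hasUnbarred j then 1 else 0
      | zero => C.reading.count zero
      | barred j => if C.hasBarred j then 1 else 0 := by
  conv_lhs => rw [C.reading_eq, count_columnWord]

theorem count_pairLetters (C : Column n) (x : Letter n) :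
    C.pairLetters.count x = match x with
      | unbarred j => if C.hasUnbarred j && C.hasBarred j then 1 else 0
      | zero => C.reading.count zero
      | barred _ => 0 := by
  rw [pairLetters_eq]
  cases x <;> simp [List.count_append, count_map_unbarred, count_filter_finRange,
    List.count_replicate]

theorem bar_injective : Function.Injective (bar (n := n)) := by
  rintro (_ | _ | _) (_ | _ | _) h <;> simp_all [bar]

theorem count_map_bar (l : List (Letter n)) (x : Letter n) :
    (l.map bar).count x = l.count (bar x) := by
  have h : bar (bar x) = x := by cases x <;> rfl
  conv_lhs => rw [← h]
  exact List.count_map_of_injective _ _ bar_injective _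

theorem count_partners (u v : Fin n → Bool) (x : Letter n) :
    (partners u v).count x = match x with
      | unbarred j => if !u j && v j then 1 else 0
      | _ => 0 := by
  cases x <;> simp [partners, count_map_unbarred, count_filter_finRange]

theorem leftSpinLetters_eq
    (h : Splits c C.hasUnbarred C.hasBarred (C.reading.count zero) u v) :
    (ofSigns v).letters = C.leftSpinLetters (partners u v) := by
  ext (j | _ | j)
  · rw [unbarred_mem_iff, signs_ofSigns]
    simp only [leftSpinLetters, Finset.mem_union, List.mem_toFinset, mem_left_iff, count_reading,
      count_pairLetters, count_partners]
    rcases step_iff.1 (h.step j) with h | h | h | h | h <;> simp [h]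
  · simp [leftSpinLetters, zero_notMem, mem_left_iff, count_pairLetters, count_partners]
  · rw [barred_mem_iff, signs_ofSigns]
    simp only [leftSpinLetters, missing, Finset.mem_union, List.mem_toFinset, mem_left_iff,
      count_reading, count_pairLetters, count_partners, Finset.mem_image, Finset.mem_filter,
      Finset.mem_univ, true_and, barred.injEq, exists_eq_right]
    rcases step_iff.1 (h.step j) with h | h | h | h | h <;> simp [h]

theorem rightSpinLetters_eq
    (h : Splits c C.hasUnbarred C.hasBarred (C.reading.count zero) u v) :
    (ofSigns u).letters = C.rightSpinLetters (partners u v) := by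
  ext (j | _ | j)
  · rw [unbarred_mem_iff, signs_ofSigns]
    simp only [rightSpinLetters, missing, Finset.mem_union, List.mem_toFinset, mem_left_iff,
      mem_right_iff, count_map_bar, bar,
      count_reading, count_pairLetters, count_partners, Finset.mem_image, Finset.mem_filter,
      Finset.mem_univ, true_and, unbarred.injEq, exists_eq_right]
    rcases step_iff.1 (h.step j) with h | h | h | h | h <;> simp [h]
  · simp [rightSpinLetters, zero_notMem, mem_right_iff, count_map_bar, bar, count_pairLetters,
      count_partners]
  · rw [barred_mem_iff, signs_ofSigns]
    simp only [rightSpinLetters, Finset.mem_union, List.mem_toFinset, mem_right_iff,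
      count_map_bar, bar, count_reading, count_pairLetters, count_partners]
    rcases step_iff.1 (h.step j) with h | h | h | h | h <;> simp [h]

end Column

end SpinB

theorem mainTheorem9 (n : ℕ) (hn : 1 ≤ n) :
    ∃ S : SpinB.Crystal.Iso ((SpinB.wordCrystal n).restrict (SpinB.sourceVertices n))
        ((SpinB.spinCrystal n).tensor (SpinB.spinCrystal n)),
      (∀ T : SpinB.Crystal.Iso ((SpinB.wordCrystal n).restrict (SpinB.sourceVertices n))
        ((SpinB.spinCrystal n).tensor (SpinB.spinCrystal n)), T = S) ∧
      ∀ C : SpinB.Column n, C.Admissible →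
        ∃ hw : C.reading ∈ SpinB.sourceVertices n,
          ∃ J : List (SpinB.Letter n), C.IsSplitting J ∧
            (S.toEquiv ⟨C.reading, hw⟩).1.letters = C.rightSpinLetters J ∧
            (S.toEquiv ⟨C.reading, hw⟩).2.letters = C.leftSpinLetters J := by
  refine ⟨SpinB.splitIso n, SpinB.iso_eq_splitIso, fun C hC => ?_⟩
  obtain ⟨c, u, v, h⟩ := hC.exists_splits
  have hmerge : SpinB.merge (SpinB.SpinColumn.ofSigns u, SpinB.SpinColumn.ofSigns v) =
      C.reading := by
    rw [SpinB.merge_ofSigns, h.mergeWord_eq, ← C.reading_eq]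
  have hw : C.reading ∈ SpinB.sourceVertices n := hmerge ▸ SpinB.merge_mem_sourceVertices _
  refine ⟨hw, SpinB.Column.partners u v, SpinB.Column.isSplitting_of_splits h, ?_, ?_⟩
  · rw [SpinB.splitIso_apply_of_merge_eq hw hmerge]
    exact SpinB.Column.rightSpinLetters_eq h
  · rw [SpinB.splitIso_apply_of_merge_eq hw hmerge]
    exact SpinB.Column.leftSpinLetters_eq h
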